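/- Let $\Lambda$ be an artin algebra, i.e. an algebra over a commutative artinian ring $R$ that is finitely generated as an $R$-module, and let $\Lambda\text{-mod}$ be the category of finitely generated left $\Lambda$-modules. Then $$\text{(1)}\quad \operatorname{tri.dim} D^b(\Lambda\text{-mod}) \le 2\operatorname{lrep.dis}(\Lambda)+1, \qquad \text{(2)}\quad \operatorname{ext.dim}\Lambda \le \operatorname{lrep.dis}(\Lambda)+1 .$$ The notation is as follows. * An artin algebra is *representation-finite* if it has, up to isomorphism, only finitely many indecomposable finitely generated left modules. If $\Lambda$ is representation-finite, then $\operatorname{lrep.dis}(\Lambda)=0$. Otherwise $\operatorname{lrep.dis}(\Lambda)$ is the least $s$ for which there is a chain $\Lambda=\Lambda_0\subsetneq\Lambda_1\subsetneq\cdots\subsetneq\Lambda_s$ of artin $R$-algebras, each an $R$-subalgebra of the next with the same identity, such that the Jacobson radical $\operatorname{rad}\Lambda_i$ is a left ideal of $\Lambda_{i+1}$ for all $0\le i<s$ and $\Lambda_s$ is representation-finite; it is $\infty$ if there is no such chain. * For a triangulated category $\mathcal T$ and an object $T$, let $\langle T\rangle_1$ be the class of direct summands of finite direct sums of shifts $T[i]$,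 $i\in\mathbb Z$, and let $\langle T\rangle_{n+1}$ be the class of direct summands of objects $X$ that fit in a distinguished triangle $X_1\to X\to X_2\to X_1[1]$ with $X_1\in\langle T\rangle_1$ and $X_2\in\langle T\rangle_{n}$ ($n\ge 1$). Then $\operatorname{tri.dim}\mathcal T$ is the least $n\ge 0$ such that $\mathcal T=\langle T\rangle_{n+1}$ for some object $T$, or $\infty$ if there is none. $D^b(\Lambda\text{-mod})$ is the bounded derived category of $\Lambda\text{-mod}$. * For a class $\mathcal U$ in $\Lambda\text{-mod}$, let $\operatorname{add}\mathcal U$ be the class of direct summands of finite direct sums of modules in $\mathcal U$. For $T\in\Lambda\text{-mod}$, put $[T]_1=\operatorname{add}\{T\}$ and, for $n\ge 2$, $[T]_n=\operatorname{add}\{M : \text{there is a short exact sequence } 0\to U_1\to M\to U_2\to 0 \text{ with } U_1\in[T]_1,\ U_2\in[T]_{n-1}\}$. Then $\operatorname{ext.dim}\Lambda$ is the least $n\ge 0$ such that $\Lambda\text{-mod}=[T]_{n+1}$ for some $T\in\Lambda\text{-mod}$, or $\infty$ if there is none. -/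

import Mathlib

open CategoryTheory CategoryTheory.Limits

universe v u

/-! ### Representation-finite rings -/

/-- A module is indecomposable if it is nonzero and is not the internal direct sum of two
nonzero submodules. -/
def IsIndecomposableModule (Λ : Type u) [Ring Λ] (M : Type v) [AddCommGroup M] [Module Λ M] :
    Prop :=
  Nontrivial M ∧ ∀ A B : Submodule Λ M, IsCompl A B → A = ⊥ ∨ B = ⊥

/-- `Λ` is representation-finite: up to isomorphism there are only finitely many indecomposable
finitely generated left `Λ`-modules. -/
def IsRepresentationFinite (Λ : Type u) [Ring Λ] : Prop :=
  ∃ (n : ℕ) (M : Fin n → FGModuleCat.{u} Λ), ∀ X : FGModuleCat.{u} Λ,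
    IsIndecomposableModule Λ X → ∃ i, Nonempty (X ≃ₗ[Λ] M i)

/-! ### Left idealized extensions and the left representation distance -/

/-- An embedding `φ : Λ → Γ` of `R`-algebras (with the same identity) exhibits `Γ` as a left
idealized extension of `Λ` if the image of the Jacobson radical of `Λ` is a left ideal of `Γ`.
(`Ideal Γ` is the type of left ideals of `Γ`.) -/
def IsLeftIdealizedExtension {R Λ Γ : Type u} [CommRing R] [Ring Λ] [Algebra R Λ]
    [Ring Γ] [Algebra R Γ] (φ : Λ →ₐ[R] Γ) : Prop :=
  Function.Injective φ ∧ ∃ I : Ideal Γ, (I : Set Γ) = φ '' (Ring.jacobson Λ : Set Λ)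

/-- `HasLeftIdealizedChain R s Λ`: there is a chain `Λ = Λ₀ ⊊ Λ₁ ⊊ ⋯ ⊊ Λₛ` of `R`-algebras that
are finitely generated as `R`-modules, with the same identity, such that the radical of `Λᵢ` is a
left ideal of `Λᵢ₊₁` for all `i < s`, and such that `Λₛ` is representation-finite. The inclusion
`Λᵢ ⊊ Λᵢ₊₁` is given by an injective, non-surjective homomorphism of `R`-algebras. -/
def HasLeftIdealizedChain (R : Type u) [CommRing R] :
    ℕ → ∀ (Λ : Type u) [Ring Λ] [Algebra R Λ], Prop
  | 0, Λ, _, _ => IsRepresentationFinite Λ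
  | s + 1, Λ, _, _ => ∃ (Γ : Type u) (_ : Ring Γ) (_ : Algebra R Γ) (_ : Module.Finite R Γ)
      (φ : Λ →ₐ[R] Γ), IsLeftIdealizedExtension φ ∧ ¬ Function.Surjective φ ∧
        HasLeftIdealizedChain R s Γ

/-- The left representation distance of an artin `R`-algebra `Λ`: the minimal length of a chain
as in `HasLeftIdealizedChain`, and `⊤` if there is no such chain. It is `0` if `Λ` is
representation-finite, because of the chain of length `0`. -/
noncomputable def lrepDis (R : Type u) [CommRing R] (Λ : Type u) [Ring Λ] [Algebra R Λ] : ℕ∞ :=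
  ⨅ (s : ℕ) (_ : HasLeftIdealizedChain R s Λ), (s : ℕ∞)

/-! ### The dimension of a triangulated category -/

/-- The (Rouquier) dimension of a triangulated category `T`: the least `n` such that
`T = ⟨G⟩_{n+1}` for some object `G`, and `⊤` if there is none. Here `⟨G⟩_{n+1}` is
`(ObjectProperty.singleton G).triangEnvelopeIter n`: `⟨G⟩₁` consists of the direct summands of
finite direct sums of shifts of `G`, and each of the `n` iterations passes to the direct summands
of the extensions by objects of `⟨G⟩₁`. -/
noncomputable def triDim (T : Type u) [Category.{v} T] [HasZeroObject T] [HasShift T ℤ]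
    [Preadditive T] [∀ n : ℤ, (shiftFunctor T n).Additive] [Pretriangulated T] : ℕ∞ :=
  ⨅ (n : ℕ) (_ : ∃ G : T, (ObjectProperty.singleton G).triangEnvelopeIter n = ⊤), (n : ℕ∞)

/-- The dimension of the bounded derived category `D^b(Λ-mod)` of the abelian category of finitely
generated left modules over a left noetherian ring `Λ`. -/
noncomputable def derivedDim (Λ : Type u) [Ring Λ] [IsNoetherianRing Λ] : ℕ∞ :=
  letI : HasDerivedCategory (FGModuleCat.{u} Λ) := HasDerivedCategory.standard _
  triDim (DerivedCategory.Bounded (FGModuleCat.{u} Λ))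

/-! ### The extension dimension -/

section

variable {C : Type u} [Category.{v} C] [Abelian C]

/-- `add 𝒰`: the direct summands of finite direct sums of objects of `𝒰`. -/
def addClosure (U : ObjectProperty C) : ObjectProperty C :=
  haveI : HasFiniteBiproducts C := Abelian.hasFiniteBiproducts
  fun X => ∃ (n : ℕ) (f : Fin n → C), (∀ i, U (f i)) ∧ Nonempty (Retract X (⨁ f))

/-- The objects `M` that fit in a short exact sequence `0 ⟶ U₁ ⟶ M ⟶ U₂ ⟶ 0` with
`U₁` in `U` and `U₂` in `V`. -/
def shortExactExtensions (U V : ObjectProperty C) : ObjectProperty C :=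
  fun M => ∃ (U₁ U₂ : C) (f : U₁ ⟶ M) (g : M ⟶ U₂) (w : f ≫ g = 0),
    (ShortComplex.mk f g w).ShortExact ∧ U U₁ ∧ V U₂

/-- `𝒰 • 𝒱 = add {M | there is a short exact sequence 0 ⟶ U₁ ⟶ M ⟶ U₂ ⟶ 0 with U₁ ∈ 𝒰, U₂ ∈ 𝒱}`. -/
def bulletProduct (U V : ObjectProperty C) : ObjectProperty C :=
  addClosure (shortExactExtensions U V)

/-- `[𝒰]ₙ`: `[𝒰]₀` consists of the zero objects, `[𝒰]₁ = add 𝒰`, and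
`[𝒰]ₙ = [𝒰]₁ • [𝒰]ₙ₋₁` for `n ≥ 2`. -/
def extLayer (U : ObjectProperty C) : ℕ → ObjectProperty C
  | 0 => fun X => IsZero X
  | 1 => addClosure U
  | n + 2 => bulletProduct (addClosure U) (extLayer U (n + 1))

end

/-- The extension dimension of `Λ-mod`, for a left noetherian ring `Λ`: the least `n` such that
`Λ-mod = [T]_{n+1}` for some finitely generated left module `T`, and `⊤` if there is none. -/
noncomputable def extDim (Λ : Type u) [Ring Λ] [IsNoetherianRing Λ] : ℕ∞ :=
  ⨅ (n : ℕ) (_ : ∃ T : FGModuleCat.{u} Λ,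
    extLayer (ObjectProperty.singleton T) (n + 1) = ⊤), (n : ℕ∞)

/-!
Both bounds come from one fact about *torsionless* modules, the submodules of the modules `Λⁿ`: if
there is a chain of left idealized extensions of length `s` from `Λ` to a representation-finite
algebra, then all torsionless `Λ`-modules lie in `[T]ₛ₊₁` for a single `T`
(`exists_isTorsionless_le_extLayer`). Let `Γ` be the first extension of the chain, let
`J = rad Λ`, and let `X ⊆ Λⁿ`. Since `J` is a left ideal of `Γ`, the module `J X ⊆ Γⁿ` is a
`Γ`-submodule, hence a torsionless `Γ`-module, while `X / J X` is a direct summand of a power of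
`Λ / J`. So `X` is an extension of an object of `add (Λ / J)` by the restriction of a torsionless
`Γ`-module (`exists_iso_restrictScalarsFG`), and each step of the chain costs one layer. This uses
that extensions of `[T]ₙ` by `[T]ₘ` lie in `[T]ₘ₊ₙ` (`extLayer_add_of_shortExact`).

*Extension dimension.* An arbitrary module `M` is a quotient `Λⁿ / L` with `L` torsionless. Let `E`
be a finitely generated injective module such that every module embeds in a power of `E`
(`exists_finite_injective_cogenerator`: the injective hull of `Λ / J`). If `L` embeds in `I` with
`I ∈ add E`, then `Λⁿ` embeds in `M ⊕ I` with cokernel `I / L`. The cosyzygy `I / L` lies in a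
layer `[T']ₛ₊₁`, where `T'` depends on `T` alone (`extLayer_cosyzygy`), so that `M` lies in a fixed
`[T'']ₛ₊₂` (`exists_extLayer_eq_top`).

*Derived category.* A bounded complex is a quotient of a contractible bounded complex with free
terms. The kernel `K` is a complex with torsionless terms, isomorphic to the original complex up
to a shift (`exists_iso_shift_Q_obj`). The cycles and the boundaries of `K` are again torsionless,
and `K` is an extension of its boundaries by its cycles, both with zero differentials
(`boundedLayer_Q_obj_of_mono`). Each of these is a finite direct sum of shifts of modules in
`[T]ₛ₊₁`, so `K` lies in `⟨T⟩₂ₛ₊₂` (`triangEnvelopeIter_boundedSingle_eq_top`).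
-/

/-! ### Additive closures -/

section AddClosure

variable {C : Type u} [Category.{v} C] [Abelian C]

/-- An object lies in `add 𝒰` as soon as its identity is a finite sum of morphisms that factor
through objects of `𝒰`. -/
lemma addClosure_of_sum {U : ObjectProperty C} {X : C} {ι : Type*} [Fintype ι] (Y : ι → C)
    (hY : ∀ i, U (Y i)) (s : ∀ i, X ⟶ Y i) (r : ∀ i, Y i ⟶ X) (h : ∑ i, s i ≫ r i = 𝟙 X) :
    addClosure U X := by
  have : HasFiniteBiproducts C := Abelian.hasFiniteBiproducts
  let e := (Fintype.equivFin ι).symm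
  refine ⟨Fintype.card ι, fun i => Y (e i), fun i => hY _,
    ⟨⟨biproduct.lift fun i => s (e i), biproduct.desc fun i => r (e i), ?_⟩⟩⟩
  rw [biproduct.lift_desc, ← h]
  exact Equiv.sum_comp e fun i => s i ≫ r i

lemma addClosure.exists_sum {U : ObjectProperty C} {X : C} (hX : addClosure U X) :
    ∃ (n : ℕ) (Y : Fin n → C) (s : ∀ i, X ⟶ Y i) (r : ∀ i, Y i ⟶ X),
      (∀ i, U (Y i)) ∧ ∑ i, s i ≫ r i = 𝟙 X := by
  have : HasFiniteBiproducts C := Abelian.hasFiniteBiproducts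
  obtain ⟨n, Y, hY, ⟨ρ⟩⟩ := hX
  refine ⟨n, Y, fun i => ρ.i ≫ biproduct.π Y i, fun i => biproduct.ι Y i ≫ ρ.r, hY, ?_⟩
  have : ρ.i ≫ (∑ i, biproduct.π Y i ≫ biproduct.ι Y i) ≫ ρ.r = 𝟙 X := by
    rw [biproduct.total, Category.id_comp, ρ.retract]
  rw [← this, Preadditive.sum_comp, Preadditive.comp_sum]
  simp only [Category.assoc]

lemma le_addClosure (U : ObjectProperty C) : U ≤ addClosure U := fun X hX =>
  addClosure_of_sum (ι := Unit) (fun _ => X) (fun _ => hX) (fun _ => 𝟙 X) (fun _ => 𝟙 X) (by simp)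

lemma addClosure_le_of_le {U V : ObjectProperty C} (h : U ≤ addClosure V) :
    addClosure U ≤ addClosure V := by
  intro X hX
  obtain ⟨n, Y, s, r, hY, hsum⟩ := hX.exists_sum
  choose m Z s' r' hZ hsum' using fun i => (h _ (hY i)).exists_sum
  refine addClosure_of_sum (ι := Σ i, Fin (m i)) (fun p => Z p.1 p.2) (fun p => hZ p.1 p.2)
    (fun p => s p.1 ≫ s' p.1 p.2) (fun p => r' p.1 p.2 ≫ r p.1) ?_
  rw [Fintype.sum_sigma, ← hsum]
  refine Finset.sum_congr rfl fun i _ => ?_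
  have : s i ≫ (∑ j, s' i j ≫ r' i j) ≫ r i = s i ≫ r i := by rw [hsum', Category.id_comp]
  rw [← this, Preadditive.sum_comp, Preadditive.comp_sum]
  simp only [Category.assoc]

lemma addClosure_mono {U V : ObjectProperty C} (h : U ≤ V) : addClosure U ≤ addClosure V :=
  addClosure_le_of_le (h.trans (le_addClosure V))

lemma addClosure_addClosure (U : ObjectProperty C) : addClosure (addClosure U) = addClosure U :=
  le_antisymm (addClosure_le_of_le le_rfl) (le_addClosure _)

lemma addClosure_of_isZero (U : ObjectProperty C) {X : C} (hX : IsZero X) : addClosure U X :=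
  addClosure_of_sum (ι := Empty) (fun i => i.elim) (fun i => i.elim) (fun i => i.elim)
    (fun i => i.elim) (hX.eq_of_src _ _)

lemma addClosure.of_retract {U : ObjectProperty C} {X Y : C} (hY : addClosure U Y)
    (ρ : Retract X Y) : addClosure U X :=
  addClosure_le_of_le le_rfl X (addClosure_of_sum (ι := Unit) (fun _ => Y) (fun _ => hY)
    (fun _ => ρ.i) (fun _ => ρ.r) (by simp))

lemma addClosure.of_iso {U : ObjectProperty C} {X Y : C} (hY : addClosure U Y)
    (e : X ≅ Y) : addClosure U X :=
  hY.of_retract (.ofIso e)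

/-- An object whose identity is the sum of two morphisms factoring through objects of `add 𝒰`
lies in `add 𝒰`. -/
lemma addClosure.of_add {U : ObjectProperty C} {X Y₁ Y₂ : C} (h₁ : addClosure U Y₁)
    (h₂ : addClosure U Y₂) (s₁ : X ⟶ Y₁) (r₁ : Y₁ ⟶ X) (s₂ : X ⟶ Y₂) (r₂ : Y₂ ⟶ X)
    (h : s₁ ≫ r₁ + s₂ ≫ r₂ = 𝟙 X) : addClosure U X :=
  addClosure_le_of_le le_rfl X (addClosure_of_sum (ι := Bool) (fun b => if b then Y₁ else Y₂)
    (fun b => by cases b <;> assumption)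
    (fun b => match b with | true => s₁ | false => s₂)
    (fun b => match b with | true => r₁ | false => r₂) (by simpa using h))

lemma addClosure.biprod {U : ObjectProperty C} {X Y : C} (hX : addClosure U X)
    (hY : addClosure U Y) : addClosure U (X ⊞ Y) :=
  hX.of_add hY biprod.fst biprod.inl biprod.snd biprod.inr biprod.total

/-- A finite sum of morphisms, each of which factors through an object of a class that contains
the zero objects and is closed under binary biproducts, factors through an object of the class. -/
lemma exists_factor_sum {D : Type*} [Category D] [Preadditive D] [HasZeroObject D]
    [HasBinaryBiproducts D] {P : ObjectProperty D}
    (h0 : ∀ X, IsZero X → P X) (hP : ∀ X Y, P X → P Y → P (X ⊞ Y)) {X X' : D}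
    {ι : Type*} (t : Finset ι) (f : ι → (X ⟶ X'))
    (h : ∀ i ∈ t, ∃ (Y : D) (s : X ⟶ Y) (r : Y ⟶ X'), P Y ∧ s ≫ r = f i) :
    ∃ (Y : D) (s : X ⟶ Y) (r : Y ⟶ X'), P Y ∧ s ≫ r = ∑ i ∈ t, f i := by
  classical
  induction t using Finset.induction_on with
  | empty =>
    obtain ⟨Z, hZ⟩ := HasZeroObject.zero (C := D)
    exact ⟨Z, 0, 0, h0 Z hZ, by simp⟩
  | insert a t ha ih =>
    obtain ⟨Y, s, r, hY, e⟩ := ih fun i hi => h i (Finset.mem_insert_of_mem hi)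
    obtain ⟨Y', s', r', hY', e'⟩ := h a (Finset.mem_insert_self _ _)
    exact ⟨Y' ⊞ Y, biprod.lift s' s, biprod.desc r' r, hP _ _ hY' hY, by
      rw [biprod.lift_desc, e, e', Finset.sum_insert ha]⟩

/-- Objects of `add 𝒰` are retracts of objects of `𝒰` if `𝒰` is closed under finite biproducts. -/
lemma addClosure.exists_retract {U : ObjectProperty C} (h0 : ∀ X, IsZero X → U X)
    (hU : ∀ X Y, U X → U Y → U (X ⊞ Y)) {X : C} (hX : addClosure U X) :
    ∃ Y, U Y ∧ Nonempty (Retract X Y) := by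
  obtain ⟨n, Y, s, r, hY, h⟩ := hX.exists_sum
  obtain ⟨Z, s', r', hZ, h'⟩ := exists_factor_sum h0 hU Finset.univ (fun i => s i ≫ r i)
    fun i _ => ⟨Y i, s i, r i, hY i, rfl⟩
  exact ⟨Z, hZ, ⟨⟨s', r', h'.trans h⟩⟩⟩

end AddClosure

/-! ### Short exact sequences in an abelian category -/

section ShortExact

variable {C : Type u} [Category.{v} C] [Abelian C]

open ShortComplex

/-- A short exact sequence can be pushed out along a morphism out of its first object. -/
lemma exists_pushout_shortExact {A B Q A' : C} {f : A ⟶ B} {g : B ⟶ Q} {w : f ≫ g = 0}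
    (h : (ShortComplex.mk f g w).ShortExact) (a : A ⟶ A') :
    ∃ (B' : C) (b : B ⟶ B') (f' : A' ⟶ B') (g' : B' ⟶ Q) (w' : f' ≫ g' = 0),
      (ShortComplex.mk f' g' w').ShortExact ∧ IsPushout f a b f' ∧ b ≫ g' = g := by
  have := h.mono_f
  have := h.epi_g
  dsimp at *
  have hp := IsPushout.of_hasPushout f a
  let g' : pushout f a ⟶ Q := pushout.desc g 0 (by simp [w])
  have hg' : pushout.inl f a ≫ g' = g := pushout.inl_desc _ _ _
  have w' : pushout.inr f a ≫ g' = 0 := pushout.inr_desc _ _ _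
  refine ⟨_, pushout.inl f a, pushout.inr f a, g', w', ?_, hp, hg'⟩
  have : Epi g' := epi_of_epi_fac hg'
  refine { exact := ?_, mono_f := inferInstanceAs (Mono (pushout.inr f a)), epi_g := this }
  · apply ShortComplex.exact_of_g_is_cokernel
    refine CokernelCofork.IsColimit.ofπ' _ _ fun {Z} k hk => ?_
    refine ⟨h.exact.desc (pushout.inl f a ≫ k) ?_, ?_⟩
    · dsimp
      rw [pushout.condition_assoc, hk, comp_zero]
    · apply pushout.hom_ext
      · rw [← Category.assoc, hg']
        exact h.exact.g_desc _ _
      · rw [← Category.assoc, w', zero_comp]; exact hk.symm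

/-- The quotients of a filtration `U ⊆ M ⊆ B`: if `U → M → W` and `M → B → Q` are short exact, so
are `U → B → V` and `W → V → Q` for some `V`. -/
lemma exists_shortExact_quotient {U M W B Q : C} {i : U ⟶ M} {p : M ⟶ W} {w : i ≫ p = 0}
    (h : (ShortComplex.mk i p w).ShortExact) {j : M ⟶ B} {q : B ⟶ Q} {w' : j ≫ q = 0}
    (h' : (ShortComplex.mk j q w').ShortExact) :
    ∃ (V : C) (a : B ⟶ V) (wa : (i ≫ j) ≫ a = 0) (b : W ⟶ V) (c : V ⟶ Q) (wb : b ≫ c = 0),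
      (ShortComplex.mk (i ≫ j) a wa).ShortExact ∧ (ShortComplex.mk b c wb).ShortExact := by
  obtain ⟨V, a, b, c, wb, hb, hp, hac⟩ := exists_pushout_shortExact h' p
  have := h.epi_g
  have := h.mono_f
  have := h'.mono_f
  dsimp at *
  have ha : Epi a := (MorphismProperty.epimorphisms C).of_isPushout hp (.infer_property p)
  have wa : (i ≫ j) ≫ a = 0 := by rw [Category.assoc, hp.w, ← Category.assoc, w, zero_comp]
  refine ⟨V, a, wa, b, c, wb, { exact := ?_, mono_f := mono_comp i j, epi_g := ha }, hb⟩
  rw [ShortComplex.exact_iff_exact_up_to_refinements]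
  intro A x hx
  dsimp at x hx
  have hxq : x ≫ q = 0 := by rw [← hac, ← Category.assoc, hx, zero_comp]
  obtain ⟨y, hy⟩ : ∃ y, y ≫ j = x := ⟨_, h'.exact.lift_f x hxq⟩
  have : Mono b := hb.mono_f
  have hyp : y ≫ p = 0 := by
    rw [← cancel_mono b, Category.assoc, ← hp.w, ← Category.assoc, hy, hx, zero_comp]
  obtain ⟨z, hz⟩ : ∃ z, z ≫ i = y := ⟨_, h.exact.lift_f y hyp⟩
  exact ⟨A, 𝟙 A, inferInstance, z, by simp [← hy, ← hz]⟩

lemma shortExact_biprod {A B Q A' B' Q' : C} {f : A ⟶ B} {g : B ⟶ Q} {w : f ≫ g = 0}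
    (h : (ShortComplex.mk f g w).ShortExact) {f' : A' ⟶ B'} {g' : B' ⟶ Q'} {w' : f' ≫ g' = 0}
    (h' : (ShortComplex.mk f' g' w').ShortExact) :
    ∃ w'', (ShortComplex.mk (biprod.map f f') (biprod.map g g') w'').ShortExact := by
  have := h.mono_f
  have := h.epi_g
  have := h'.mono_f
  have := h'.epi_g
  dsimp at *
  refine ⟨by ext <;> simp [w, w'], { exact := ?_, mono_f := ?_, epi_g := ?_ }⟩
  · rw [ShortComplex.exact_iff_exact_up_to_refinements]
    intro A x hx
    dsimp at x hx
    have h1 : (x ≫ biprod.fst) ≫ g = 0 := by simpa using hx =≫ biprod.fst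
    have h2 : (x ≫ biprod.snd) ≫ g' = 0 := by simpa using hx =≫ biprod.snd
    refine ⟨A, 𝟙 A, inferInstance, biprod.lift (h.exact.lift _ h1) (h'.exact.lift _ h2), ?_⟩
    ext
    · simpa using (h.exact.lift_f _ h1).symm
    · simpa using (h'.exact.lift_f _ h2).symm
  · dsimp; infer_instance
  · dsimp; infer_instance

/-- If `A → B → Q` is short exact and `A` embeds in an injective object `I`, then `B` embeds in
`Q ⊞ I` with cokernel `I / A`. -/
lemma exists_shortExact_rotate {A B Q I K : C} {f : A ⟶ B} {g : B ⟶ Q} {w : f ≫ g = 0}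
    (h : (ShortComplex.mk f g w).ShortExact) {j : A ⟶ I} {q : I ⟶ K} {w' : j ≫ q = 0}
    (h' : (ShortComplex.mk j q w').ShortExact) [Injective I] :
    ∃ (a : B ⟶ Q ⊞ I) (b : Q ⊞ I ⟶ K) (w'' : a ≫ b = 0), (ShortComplex.mk a b w'').ShortExact := by
  obtain ⟨E, b, f', g', wg, hE, hp, -⟩ := exists_pushout_shortExact h j
  obtain ⟨E', b', f'', g'', wg', hE', hp', -⟩ := exists_pushout_shortExact h' f
  have e : E' ≅ E := hp'.flip.isoIsPushout _ _ hp
  have σ := hE.splittingOfInjective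
  let e' : Q ⊞ I ≅ E' := biprod.braiding _ _ ≪≫ σ.isoBinaryBiproduct.symm ≪≫ e.symm
  refine ⟨f'' ≫ e'.inv, e'.hom ≫ g'', by simp [wg'], ?_⟩
  refine ShortComplex.shortExact_of_iso ?_ hE'
  exact ShortComplex.isoMk (Iso.refl _) e'.symm (Iso.refl _) (by simp) (by simp)

end ShortExact

/-! ### The layers `[𝒰]ₙ` -/

section ExtLayer

variable {C : Type u} [Category.{v} C] [Abelian C]

lemma shortExactExtensions_mono {U U' V V' : ObjectProperty C} (hU : U ≤ U') (hV : V ≤ V') :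
    shortExactExtensions U V ≤ shortExactExtensions U' V' := by
  rintro M ⟨U₁, U₂, f, g, w, h, h₁, h₂⟩
  exact ⟨U₁, U₂, f, g, w, h, hU _ h₁, hV _ h₂⟩

lemma shortExactExtensions.biprod {U V : ObjectProperty C}
    {M N : C} (hM : shortExactExtensions (addClosure U) (addClosure V) M)
    (hN : shortExactExtensions (addClosure U) (addClosure V) N) :
    shortExactExtensions (addClosure U) (addClosure V) (M ⊞ N) := by
  obtain ⟨A, B, f, g, w, h, hA, hB⟩ := hM
  obtain ⟨A', B', f', g', w', h', hA', hB'⟩ := hN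
  obtain ⟨w'', h''⟩ := shortExact_biprod h h'
  exact ⟨_, _, _, _, w'', h'', hA.biprod hA', hB.biprod hB'⟩

lemma shortExactExtensions_of_isZero {U V : ObjectProperty C} {M : C} (hM : IsZero M) :
    shortExactExtensions (addClosure U) (addClosure V) M := by
  refine ⟨M, M, 𝟙 M, 0, by simp, ?_, addClosure_of_isZero U hM, addClosure_of_isZero V hM⟩
  exact { exact := ShortComplex.exact_of_isZero_X₂ _ hM
          mono_f := inferInstanceAs (Mono (𝟙 M))
          epi_g := ⟨fun _ _ _ => hM.eq_of_src _ _⟩ }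

lemma addClosure_extLayer (U : ObjectProperty C) (n : ℕ) :
    addClosure (extLayer U (n + 1)) = extLayer U (n + 1) := by
  cases n <;> exact addClosure_addClosure _

lemma extLayer_mono {U V : ObjectProperty C} (h : U ≤ addClosure V) (n : ℕ) :
    extLayer U (n + 1) ≤ extLayer V (n + 1) := by
  induction n with
  | zero => exact addClosure_le_of_le h
  | succ n ih => exact addClosure_mono (shortExactExtensions_mono (addClosure_le_of_le h) ih)

lemma extLayer_of_isZero (U : ObjectProperty C) (n : ℕ) {X : C} (hX : IsZero X) :
    extLayer U (n + 1) X := by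
  rw [← addClosure_extLayer]
  exact addClosure_of_isZero _ hX

lemma extLayer.of_retract {U : ObjectProperty C} {n : ℕ} {X Y : C} (hY : extLayer U (n + 1) Y)
    (ρ : Retract X Y) : extLayer U (n + 1) X := by
  rw [← addClosure_extLayer] at *
  exact hY.of_retract ρ

lemma extLayer.of_iso {U : ObjectProperty C} {n : ℕ} {X Y : C} (hY : extLayer U (n + 1) Y)
    (e : X ≅ Y) : extLayer U (n + 1) X :=
  hY.of_retract (.ofIso e)

lemma extLayer_of_shortExact {U : ObjectProperty C} {n : ℕ} {A B Q : C} {f : A ⟶ B} {g : B ⟶ Q}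
    {w : f ≫ g = 0} (h : (ShortComplex.mk f g w).ShortExact) (hA : addClosure U A)
    (hQ : extLayer U (n + 1) Q) : extLayer U (n + 2) B :=
  le_addClosure _ B ⟨A, Q, f, g, w, h, hA, hQ⟩

lemma addClosure_le_extLayer (U : ObjectProperty C) (n : ℕ) :
    addClosure U ≤ extLayer U (n + 1) := by
  intro X hX
  cases n with
  | zero => exact hX
  | succ n =>
    obtain ⟨Z, hZ⟩ := HasZeroObject.zero (C := C)
    refine extLayer_of_shortExact (f := 𝟙 X) (g := (0 : X ⟶ Z)) (w := by simp) ?_ hX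
      (extLayer_of_isZero U n hZ)
    exact { exact := (ShortComplex.exact_iff_epi _ rfl).2 (inferInstanceAs (Epi (𝟙 X)))
            mono_f := inferInstanceAs (Mono (𝟙 X))
            epi_g := ⟨fun _ _ _ => hZ.eq_of_src _ _⟩ }

/-- Associativity of the bullet product: extensions of `[𝒰]ₙ` by `[𝒰]ₘ` lie in `[𝒰]ₘ₊ₙ`. -/
lemma extLayer_add_of_shortExact {U : ObjectProperty C} (m n : ℕ) {A B Q : C} {f : A ⟶ B}
    {g : B ⟶ Q} {w : f ≫ g = 0} (h : (ShortComplex.mk f g w).ShortExact)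
    (hA : extLayer U (m + 1) A) (hQ : extLayer U (n + 1) Q) : extLayer U (m + n + 2) B := by
  induction m generalizing A B Q with
  | zero =>
    rw [Nat.zero_add]
    exact extLayer_of_shortExact h hA hQ
  | succ m ih =>
    have hA' : addClosure (shortExactExtensions (addClosure U)
        (addClosure (extLayer U (m + 1)))) A := by
      rw [addClosure_extLayer]
      exact hA
    obtain ⟨A', ⟨U₁, U₂, i, p, wi, hip, hU₁, hU₂⟩, ⟨ρ⟩⟩ := hA'.exists_retract
      (fun X hX => shortExactExtensions_of_isZero hX) fun X Y hX hY => hX.biprod hY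
    rw [addClosure_extLayer] at hU₂
    -- `B` is a retract of the pushout `B'` along the inclusion of the summand `A` of `A'`.
    obtain ⟨B', b, f', g', w', h', hp, -⟩ := exists_pushout_shortExact h ρ.i
    let σ : Retract B B' :=
      { i := b
        r := hp.desc (𝟙 B) (ρ.r ≫ f) (by simp)
        retract := hp.inl_desc _ _ _ }
    obtain ⟨V, a, wa, c, d, wc, hV, hV'⟩ := exists_shortExact_quotient hip h'
    have := extLayer_of_shortExact hV hU₁ (ih hV' hU₂ hQ)
    rw [show m + 1 + n + 2 = m + n + 1 + 2 by omega]
    exact extLayer.of_retract this σ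

lemma addClosure.map {D : Type*} [Category D] [Abelian D] (F : C ⥤ D) [F.Additive]
    {U : ObjectProperty C} {V : ObjectProperty D} (hUV : ∀ X, U X → addClosure V (F.obj X))
    {X : C} (hX : addClosure U X) : addClosure V (F.obj X) := by
  obtain ⟨n, Y, s, r, hY, h⟩ := hX.exists_sum
  rw [← addClosure_addClosure]
  refine addClosure_of_sum (fun i => F.obj (Y i)) (fun i => hUV _ (hY i)) (fun i => F.map (s i))
    (fun i => F.map (r i)) ?_
  simp only [← F.map_comp, ← F.map_sum, h, F.map_id]

lemma extLayer.map {D : Type*} [Category D] [Abelian D] (F : C ⥤ D) [F.Additive]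
    (hF : ∀ S : ShortComplex C, S.ShortExact → (S.map F).ShortExact)
    {U : ObjectProperty C} {V : ObjectProperty D} (hUV : ∀ X, U X → V (F.obj X))
    {n : ℕ} {X : C} (hX : extLayer U (n + 1) X) : extLayer V (n + 1) (F.obj X) := by
  have h0 : ∀ X, U X → addClosure V (F.obj X) := fun X hX => le_addClosure _ _ (hUV X hX)
  induction n generalizing X with
  | zero => exact addClosure.map F h0 hX
  | succ n ih =>
    refine addClosure.map F (fun M hM => ?_) hX
    obtain ⟨U₁, U₂, f, g, w, h, h₁, h₂⟩ := hM
    exact le_addClosure _ _ ⟨_, _, _, _, _, hF _ h, addClosure.map F h0 h₁, ih h₂⟩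

end ExtLayer

/-! ### Cosyzygies -/

section Cosyzygy

variable {C : Type u} [Category.{v} C] [Abelian C]

lemma addClosure_singleton_self (X : C) : addClosure (.singleton X) X :=
  le_addClosure _ _ (by simp)

lemma injective_of_addClosure_singleton {E J : C} [Injective E]
    (hJ : addClosure (.singleton E) J) : Injective J := by
  obtain ⟨J', hJ', ⟨ρ⟩⟩ := (addClosure_mono (V := fun X => Injective X)
    (by rintro X ⟨⟩; infer_instance) J hJ).exists_retract
    (fun X hX => ⟨fun _ _ _ => ⟨0, hX.eq_of_tgt _ _⟩⟩)
    (fun X Y (hX : Injective X) (hY : Injective Y) => inferInstanceAs (Injective (X ⊞ Y)))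
  have : Injective J' := hJ'
  exact ⟨fun a i _ => ⟨Injective.factorThru (a ≫ ρ.i) i ≫ ρ.r, by simp⟩⟩

lemma shortExact_cokernel {X Y : C} (i : X ⟶ Y) [Mono i] :
    (ShortComplex.mk i (cokernel.π i) (cokernel.condition i)).ShortExact :=
  { exact := ShortComplex.exact_cokernel i
    mono_f := inferInstanceAs (Mono i)
    epi_g := inferInstanceAs (Epi (cokernel.π i)) }

/-- If the identity of `L` is a sum of morphisms factoring through the objects `Mᵢ`, then any
cosyzygy `Q` of `L` lies in the additive closure of cosyzygies `Qᵢ` of the `Mᵢ` and of the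
injective object `J` that contains `L`. -/
lemma addClosure_cosyzygy_of_sum {V : ObjectProperty C} {L J Q : C} {j : L ⟶ J} {q : J ⟶ Q}
    {w : j ≫ q = 0} (h : (ShortComplex.mk j q w).ShortExact) [Injective J]
    {n : ℕ} {M : Fin n → C} (s : ∀ i, L ⟶ M i) (r : ∀ i, M i ⟶ L) (hsum : ∑ i, s i ≫ r i = 𝟙 L)
    (hJ : addClosure V J)
    (hM : ∀ i, ∃ (I K : C) (a : M i ⟶ I) (b : I ⟶ K) (w : a ≫ b = 0),
      (ShortComplex.mk a b w).ShortExact ∧ Injective I ∧ addClosure V K) :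
    addClosure V Q := by
  choose I K a b wab hab hI hK using hM
  have := h.mono_f
  have := h.epi_g
  have := fun i => (hab i).mono_f
  have := fun i => (hab i).epi_g
  dsimp at *
  -- Extend `s i` and `r i` to the injective objects, and pass to the cokernels.
  let S : ∀ i, J ⟶ I i := fun i => Injective.factorThru (s i ≫ a i) j
  have hS : ∀ i, j ≫ S i = s i ≫ a i := fun i => Injective.comp_factorThru _ _
  let R : ∀ i, I i ⟶ J := fun i => Injective.factorThru (r i ≫ j) (a i)
  have hR : ∀ i, a i ≫ R i = r i ≫ j := fun i => Injective.comp_factorThru _ _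
  have hS' : ∀ i, ∃ S' : Q ⟶ K i, q ≫ S' = S i ≫ b i := fun i =>
    ⟨h.exact.desc (S i ≫ b i) (by
      dsimp; rw [← Category.assoc, hS, Category.assoc, wab, comp_zero]), h.exact.g_desc _ _⟩
  have hR' : ∀ i, ∃ R' : K i ⟶ Q, b i ≫ R' = R i ≫ q := fun i =>
    ⟨(hab i).exact.desc (R i ≫ q) (by
      dsimp; rw [← Category.assoc, hR, Category.assoc, w, comp_zero]), (hab i).exact.g_desc _ _⟩
  choose S' hS' using hS'
  choose R' hR' using hR'
  -- The difference between the identity of `J` and `∑ S i ≫ R i` vanishes on `L`.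
  have hD : j ≫ (𝟙 J - ∑ i, S i ≫ R i) = 0 := by
    rw [Preadditive.comp_sub, Preadditive.comp_sum, Category.comp_id, sub_eq_zero]
    calc j = (∑ i, s i ≫ r i) ≫ j := by rw [hsum, Category.id_comp]
      _ = ∑ i, j ≫ S i ≫ R i := by
        rw [Preadditive.sum_comp]
        refine Finset.sum_congr rfl fun i _ => ?_
        rw [← Category.assoc, hS, Category.assoc, Category.assoc, hR]
  obtain ⟨D, hD⟩ : ∃ D : Q ⟶ J, q ≫ D = 𝟙 J - ∑ i, S i ≫ R i :=
    ⟨h.exact.desc _ hD, h.exact.g_desc _ _⟩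
  rw [← addClosure_addClosure]
  refine addClosure_of_sum (ι := Option (Fin n)) (fun o => o.elim J K)
    (fun o => by cases o; exacts [hJ, hK _])
    (fun o => match o with | none => D | some i => S' i)
    (fun o => match o with | none => q | some i => R' i) ?_
  refine (Fintype.sum_option _).trans ?_
  change D ≫ q + ∑ i, S' i ≫ R' i = 𝟙 Q
  rw [← cancel_epi q, Preadditive.comp_add, Preadditive.comp_sum,
    ← Category.assoc, hD, Preadditive.sub_comp, Preadditive.sum_comp]
  have : ∀ i, q ≫ S' i ≫ R' i = (S i ≫ R i) ≫ q := fun i => by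
    rw [← Category.assoc, hS', Category.assoc, hR', Category.assoc]
  simp [this]

/-- Let `E` be an injective object such that every object embeds in an object of `add E`, and let
`T → I → K` be short exact with `I` in `add E`. Then the cosyzygies of the objects of `[T]ₙ`
lie in `[K ⊞ E]ₙ`. -/
lemma extLayer_cosyzygy {E T I K : C} [Injective E]
    (hE : ∀ X : C, ∃ (J : C) (j : X ⟶ J), addClosure (.singleton E) J ∧ Mono j)
    {f : T ⟶ I} {g : I ⟶ K} {w : f ≫ g = 0} (hT : (ShortComplex.mk f g w).ShortExact)
    (hI : addClosure (.singleton E) I) (n : ℕ) {L J Q : C} {j : L ⟶ J} {q : J ⟶ Q}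
    {w' : j ≫ q = 0} (h : (ShortComplex.mk j q w').ShortExact)
    (hJ : addClosure (.singleton E) J) (hL : extLayer (.singleton T) (n + 1) L) :
    extLayer (.singleton (K ⊞ E)) (n + 1) Q := by
  have hinj := fun J hJ => injective_of_addClosure_singleton (E := E) (J := J) hJ
  have hle : ∀ n, addClosure (.singleton E) ≤ extLayer (.singleton (K ⊞ E)) (n + 1) := fun n =>
    (addClosure_le_of_le (by
      rintro X ⟨⟩
      exact (addClosure_singleton_self _).of_retract (.mk biprod.inr biprod.snd))).trans
      (addClosure_le_extLayer _ n)
  have key : ∀ (n : ℕ) {U : ObjectProperty C}, (∀ M, U M → ∃ (I K' : C) (a : M ⟶ I) (b : I ⟶ K')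
      (w : a ≫ b = 0), (ShortComplex.mk a b w).ShortExact ∧ Injective I ∧
        extLayer (.singleton (K ⊞ E)) (n + 1) K') → ∀ {L J Q : C} {j : L ⟶ J} {q : J ⟶ Q}
      {w' : j ≫ q = 0}, (ShortComplex.mk j q w').ShortExact → addClosure (.singleton E) J →
      addClosure U L → extLayer (.singleton (K ⊞ E)) (n + 1) Q := by
    intro n U hU L J Q j q w' h hJ hL
    have := hinj J hJ
    obtain ⟨m, Y, s, r, hY, hsum⟩ := hL.exists_sum
    rw [← addClosure_extLayer]
    refine addClosure_cosyzygy_of_sum h s r hsum (le_addClosure _ _ (hle n J hJ)) fun i => ?_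
    obtain ⟨I, K', a, b, w, h1, h2, h3⟩ := hU _ (hY i)
    exact ⟨I, K', a, b, w, h1, h2, le_addClosure _ _ h3⟩
  have h1 : ∀ {L J Q : C} {j : L ⟶ J} {q : J ⟶ Q} {w' : j ≫ q = 0},
      (ShortComplex.mk j q w').ShortExact → addClosure (.singleton E) J →
      addClosure (.singleton T) L → addClosure (.singleton (K ⊞ E)) Q := by
    intro L J Q j q w' h hJ hL
    refine key 0 ?_ h hJ hL
    rintro M ⟨⟩
    exact ⟨I, K, f, g, w, hT, hinj I hI,
      (addClosure_singleton_self _).of_retract (.mk biprod.inl biprod.fst)⟩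
  induction n generalizing L J Q with
  | zero => exact h1 h hJ hL
  | succ n ih =>
    refine key (n + 1) ?_ h hJ hL
    rintro M ⟨U₁, U₂, a, b, wab, hab, hU₁, hU₂⟩
    obtain ⟨J₁, i, hJ₁, hi⟩ := hE M
    obtain ⟨J₂, i', hJ₂, hi'⟩ := hE U₂
    refine ⟨J₁, _, i, cokernel.π i, cokernel.condition i, shortExact_cokernel i, hinj _ hJ₁, ?_⟩
    obtain ⟨V, c, wc, d, e, wd, hV, hV'⟩ := exists_shortExact_quotient hab (shortExact_cokernel i)
    have := hinj _ hJ₂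
    obtain ⟨x, y, wxy, hxy⟩ := exists_shortExact_rotate hV' (shortExact_cokernel i')
    exact (extLayer_of_shortExact hxy (h1 hV hJ₁ hU₁)
      (ih (shortExact_cokernel i') hJ₂ hU₂)).of_retract (.mk biprod.inl biprod.fst)

/-- Suppose that every object embeds in an object of `add E` with `E` injective. If every object
is a quotient of some `F ∈ add P` by an object of `[T]ₙ`, then every object lies in `[T']ₙ₊₁` for
some fixed `T'`. -/
lemma exists_extLayer_eq_top {E T P : C} [Injective E]
    (hE : ∀ X : C, ∃ (J : C) (j : X ⟶ J), addClosure (.singleton E) J ∧ Mono j) (n : ℕ)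
    (hP : ∀ X : C, ∃ (L F : C) (f : L ⟶ F) (g : F ⟶ X) (w : f ≫ g = 0),
      (ShortComplex.mk f g w).ShortExact ∧ addClosure (.singleton P) F ∧
        extLayer (.singleton T) (n + 1) L) :
    ∃ T' : C, extLayer (.singleton T') (n + 2) = ⊤ := by
  obtain ⟨I, f, hI, hf⟩ := hE T
  refine ⟨(cokernel f ⊞ E) ⊞ P, top_le_iff.1 fun X _ => ?_⟩
  obtain ⟨L, F, a, b, w, h, hF, hL⟩ := hP X
  obtain ⟨J, j, hJ, hj⟩ := hE L
  have := injective_of_addClosure_singleton hJ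
  have hQ := extLayer_cosyzygy hE (shortExact_cokernel f) hI n (shortExact_cokernel j) hJ hL
  obtain ⟨x, y, wxy, hxy⟩ := exists_shortExact_rotate h (shortExact_cokernel j)
  have hF' : addClosure (.singleton ((cokernel f ⊞ E) ⊞ P)) F := addClosure_le_of_le (by
    rintro X ⟨⟩
    exact (addClosure_singleton_self _).of_retract (.mk biprod.inr biprod.snd)) F hF
  have hQ' := extLayer_mono (V := .singleton ((cokernel f ⊞ E) ⊞ P)) (by
    rintro X ⟨⟩
    exact (addClosure_singleton_self _).of_retract (.mk biprod.inl biprod.fst)) n _ hQ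
  exact (extLayer_of_shortExact hxy hF' hQ').of_retract (.mk biprod.inl biprod.fst)

end Cosyzygy

/-! ### Layers in a triangulated category -/

section Triangulated

open ObjectProperty Pretriangulated

variable {T : Type*} [Category T] [HasZeroObject T] [HasShift T ℤ] [Preadditive T]
  [∀ n : ℤ, (shiftFunctor T n).Additive] [Pretriangulated T]

lemma extensionProduct_biprod {P Q : ObjectProperty T} [P.IsStableUnderRetracts]
    [Q.IsStableUnderRetracts] (hP : ∀ X Y, P X → P Y → P (X ⊞ Y))
    (hQ : ∀ X Y, Q X → Q Y → Q (X ⊞ Y)) {X Y : T} (hX : extensionProduct P Q X)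
    (hY : extensionProduct P Q Y) : extensionProduct P Q (X ⊞ Y) := by
  let κ : ∀ F : Bool → T, ∏ᶜ F ≅ F true ⊞ F false := fun F =>
    { hom := biprod.lift (Pi.π F true) (Pi.π F false)
      inv := Pi.lift fun b => match b with | true => biprod.fst | false => biprod.snd
      hom_inv_id := by
        refine Pi.hom_ext _ _ fun b => ?_
        cases b <;> simp
      inv_hom_id := by ext <;> simp }
  obtain ⟨X₁, X₃, f, g, h, hT, hX₁, hX₃⟩ := hX
  obtain ⟨Y₁, Y₃, f', g', h', hT', hY₁, hY₃⟩ := hY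
  let D : Bool → Triangle T := fun b => if b then .mk f g h else .mk f' g' h'
  have hD := productTriangle_distinguished D (by rintro (_ | _); exacts [hT', hT])
  refine (extensionProduct P Q).prop_of_iso (κ fun b => (D b).obj₂) ⟨_, _, _, _, _, hD, ?_, ?_⟩
  · exact P.prop_of_retract (.ofIso (κ fun b => (D b).obj₁)) (hP _ _ hX₁ hY₁)
  · exact Q.prop_of_retract (.ofIso (κ fun b => (D b).obj₃)) (hQ _ _ hX₃ hY₃)

lemma retractClosure_biprod {P : ObjectProperty T} (hP : ∀ X Y, P X → P Y → P (X ⊞ Y)) {X Y : T}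
    (hX : P.retractClosure X) (hY : P.retractClosure Y) : P.retractClosure (X ⊞ Y) := by
  obtain ⟨X', hX', ⟨ρ⟩⟩ := hX
  obtain ⟨Y', hY', ⟨σ⟩⟩ := hY
  exact ⟨X' ⊞ Y', hP _ _ hX' hY', ⟨⟨biprod.map ρ.i σ.i, biprod.map ρ.r σ.r, by
    ext <;> simp⟩⟩⟩

lemma triangEnvelopeIter_biprod (P : ObjectProperty T) (n : ℕ) {X Y : T}
    (hX : P.triangEnvelopeIter n X) (hY : P.triangEnvelopeIter n Y) :
    P.triangEnvelopeIter n (X ⊞ Y) := by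
  have h0 : ∀ X Y, (P.shiftClosure ℤ).binaryProductsClosure.retractClosure X →
      (P.shiftClosure ℤ).binaryProductsClosure.retractClosure Y →
      (P.shiftClosure ℤ).binaryProductsClosure.retractClosure (X ⊞ Y) := fun X Y hX hY =>
    retractClosure_biprod (fun X Y hX hY =>
      (P.shiftClosure ℤ).binaryProductsClosure.prop_of_isLimit_binaryFan
        (BinaryBiproduct.isLimit X Y) hX hY) hX hY
  induction n generalizing X Y with
  | zero =>
    rw [triangEnvelopeIter_zero] at *
    exact h0 _ _ hX hY
  | succ n ih =>
    rw [triangEnvelopeIter_succ] at *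
    exact retractClosure_biprod
      (fun _ _ h h' => extensionProduct_biprod h0 (fun _ _ h h' => ih h h') h h') hX hY

lemma triangEnvelopeIter_of_isZero (P : ObjectProperty T) [P.Nonempty] (n : ℕ) {X : T}
    (hX : IsZero X) : P.triangEnvelopeIter n X :=
  (P.triangEnvelopeIter n).prop_of_retract
    { i := 0, r := 0, retract := hX.eq_of_src _ _ } (P.le_triangEnvelopeIter n _ P.prop_arbitrary)

end Triangulated

/-! ### Layers in the bounded derived category -/

section Derived

open ObjectProperty Pretriangulated DerivedCategory

universe w

variable {C : Type u} [Category.{v} C] [Abelian C] [HasDerivedCategory.{w} C]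

/-- The bounded derived category object given by the complex with `M` in degree `0`. -/
noncomputable def boundedSingle (M : C) : DerivedCategory.Bounded C :=
  ⟨(singleFunctor C 0).obj M, ⟨0, inferInstance⟩, ⟨0, inferInstance⟩⟩

/-- The objects of the derived category that are bounded and lie in `⟨T⟩ₙ₊₁`, as objects of the
bounded derived category. -/
def boundedLayer (T : C) (n : ℕ) : ObjectProperty (DerivedCategory C) := fun X =>
  ∃ h : (TStructure.t : Triangulated.TStructure (DerivedCategory C)).bounded X,
    (ObjectProperty.singleton (boundedSingle T)).triangEnvelopeIter n ⟨X, h⟩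

variable {T : C} {n : ℕ}

lemma boundedLayer.of_iso {X Y : DerivedCategory C} (hY : boundedLayer T n Y) (e : X ≅ Y) :
    boundedLayer T n X := by
  obtain ⟨h, hY⟩ := hY
  have h' := ObjectProperty.prop_of_iso _ e.symm h
  refine ⟨h', ObjectProperty.prop_of_iso _ ?_ hY⟩
  exact (fullyFaithfulι _).preimageIso e.symm

lemma boundedLayer.shift {X : DerivedCategory C} (hX : boundedLayer T n X) (a : ℤ) :
    boundedLayer T n (X⟦a⟧) := by
  obtain ⟨h, hX⟩ := hX
  refine of_iso (Y := ((⟨X, h⟩ : DerivedCategory.Bounded C)⟦a⟧).obj)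
    ⟨((⟨X, h⟩ : DerivedCategory.Bounded C)⟦a⟧).property, ?_⟩
    (((Bounded.ι).commShiftIso a).app (⟨X, h⟩ : DerivedCategory.Bounded C)).symm
  exact IsStableUnderShiftBy.le_shift _ hX

lemma boundedLayer_of_distTriang {m : ℕ} {D : Triangle (DerivedCategory C)}
    (hD : D ∈ distTriang (DerivedCategory C)) (h₁ : boundedLayer T m D.obj₁)
    (h₃ : boundedLayer T n D.obj₃) : boundedLayer T (m + n + 1) D.obj₂ := by
  obtain ⟨b₁, h₁⟩ := h₁
  obtain ⟨b₃, h₃⟩ := h₃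
  have b₂ := ObjectProperty.ext_of_isTriangulatedClosed₂ _ D hD b₁ b₃
  refine ⟨b₂, ?_⟩
  rw [add_assoc, triangEnvelopeIter_add' _ rfl]
  refine le_retractClosure _ _ ⟨⟨_, b₁⟩, ⟨_, b₃⟩, (fullyFaithfulι _).preimage D.mor₁,
    (fullyFaithfulι _).preimage D.mor₂, (fullyFaithfulι _).preimage
      (D.mor₃ ≫ ((Bounded.ι).commShiftIso (1 : ℤ)).inv.app (⟨_, b₁⟩ : DerivedCategory.Bounded C)),
    ?_, h₁, h₃⟩
  refine isomorphic_distinguished _ hD _ (Triangle.isoMk _ _ (Iso.refl _) (Iso.refl _)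
    (Iso.refl _) ?_ ?_ ?_)
  · exact (Category.comp_id _).trans (Category.id_comp _).symm
  · exact (Category.comp_id _).trans (Category.id_comp _).symm
  · refine (congrArg (_ ≫ ·) ((shiftFunctor (DerivedCategory C) (1 : ℤ)).map_id _)).trans ?_
    refine (Category.comp_id _).trans (Eq.trans ?_ (Category.id_comp _).symm)
    let A : DerivedCategory.Bounded C := ⟨D.obj₁, b₁⟩
    change (D.mor₃ ≫ ((Bounded.ι).commShiftIso (1 : ℤ)).inv.app A) ≫
      ((Bounded.ι).commShiftIso (1 : ℤ)).hom.app A = D.mor₃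
    rw [Category.assoc, Iso.inv_hom_id_app]
    exact Category.comp_id _

/-- A bounded object whose identity is a finite sum of morphisms that factor through objects of
`⟨T⟩ₙ₊₁` lies in `⟨T⟩ₙ₊₁`. -/
lemma boundedLayer_of_sum {X : DerivedCategory C}
    (hX : (TStructure.t : Triangulated.TStructure (DerivedCategory C)).bounded X)
    {ι : Type*} (t : Finset ι) (Y : ι → DerivedCategory C) (hY : ∀ i, boundedLayer T n (Y i))
    (s : ∀ i, X ⟶ Y i) (r : ∀ i, Y i ⟶ X) (h : ∑ i ∈ t, s i ≫ r i = 𝟙 X) :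
    boundedLayer T n X := by
  choose b hY using hY
  obtain ⟨Z, s', r', hZ, hsr⟩ := exists_factor_sum
    (P := (ObjectProperty.singleton (boundedSingle T)).triangEnvelopeIter n)
    (fun X hX => triangEnvelopeIter_of_isZero _ n hX)
    (fun X Y hX hY => triangEnvelopeIter_biprod _ n hX hY) t
    (X := (⟨X, hX⟩ : DerivedCategory.Bounded C)) (X' := (⟨X, hX⟩ : DerivedCategory.Bounded C))
    (fun i => (fullyFaithfulι _).preimage (s i ≫ r i)) (fun i _ =>
      ⟨⟨Y i, b i⟩, (fullyFaithfulι _).preimage (s i), (fullyFaithfulι _).preimage (r i), hY i, by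
        apply (fullyFaithfulι _).map_injective
        simp⟩)
  refine ⟨hX, ObjectProperty.prop_of_retract _ ⟨s', r', hsr.trans ?_⟩ hZ⟩
  apply (fullyFaithfulι _).map_injective
  rw [Functor.map_sum]
  simpa using h

lemma bounded_Q_obj {K : CochainComplex C ℤ} (a b : ℤ) [K.IsStrictlyGE a] [K.IsStrictlyLE b] :
    (TStructure.t : Triangulated.TStructure (DerivedCategory C)).bounded (Q.obj K) :=
  ⟨⟨a, inferInstance⟩, ⟨b, inferInstance⟩⟩

/-- Modules in `[T]ₙ₊₁` lie in `⟨T⟩ₙ₊₁`. -/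
lemma boundedLayer_of_extLayer {M : C} (hM : extLayer (.singleton T) (n + 1) M) :
    boundedLayer T n ((singleFunctor C 0).obj M) := by
  have key : ∀ {n : ℕ} {U : ObjectProperty C}, (∀ N, U N →
      boundedLayer T n ((singleFunctor C 0).obj N)) → ∀ {M : C}, addClosure U M →
      boundedLayer T n ((singleFunctor C 0).obj M) := by
    intro n U hU M hM
    obtain ⟨m, Y, s, r, hY, h⟩ := hM.exists_sum
    refine boundedLayer_of_sum ⟨⟨0, inferInstance⟩, ⟨0, inferInstance⟩⟩ Finset.univ _
      (fun i => hU _ (hY i)) (fun i => (singleFunctor C 0).map (s i))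
      (fun i => (singleFunctor C 0).map (r i)) ?_
    simp only [← Functor.map_comp, ← Functor.map_sum, h, CategoryTheory.Functor.map_id]
  have h0 : ∀ {M : C}, addClosure (.singleton T) M →
      boundedLayer T 0 ((singleFunctor C 0).obj M) := by
    intro M hM
    refine key ?_ hM
    rintro N ⟨⟩
    exact ⟨(boundedSingle T).property, le_triangEnvelopeIter _ _ (boundedSingle T) (by simp)⟩
  induction n generalizing M with
  | zero => exact h0 hM
  | succ n ih =>
    refine key ?_ hM
    rintro N ⟨U₁, U₂, f, g, w, h, h₁, h₂⟩
    have := boundedLayer_of_distTriang h.singleTriangle_distinguished (h0 h₁) (ih h₂)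
    rwa [Nat.zero_add] at this

lemma boundedLayer.single {M : C} (hM : boundedLayer T n ((singleFunctor C 0).obj M)) (i : ℤ) :
    boundedLayer T n ((singleFunctor C i).obj M) :=
  (hM.shift (-i)).of_iso (((singleFunctors C).shiftIso (-i) i 0 (by simp)).app M).symm

/-- A bounded complex with zero differentials is the sum of its terms, placed in their degrees. -/
lemma boundedLayer_Q_obj_of_d_eq_zero {K : CochainComplex C ℤ} (a b : ℤ) [K.IsStrictlyGE a]
    [K.IsStrictlyLE b] (hd : ∀ i j, K.d i j = 0)
    (hK : ∀ i, boundedLayer T n ((singleFunctor C 0).obj (K.X i))) :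
    boundedLayer T n (Q.obj K) := by
  let s : ∀ i, K ⟶ (HomologicalComplex.single C (.up ℤ) i).obj (K.X i) := fun i =>
    HomologicalComplex.mkHomToSingle (𝟙 _) fun j _ => by simp [hd]
  let r : ∀ i, (HomologicalComplex.single C (.up ℤ) i).obj (K.X i) ⟶ K := fun i =>
    HomologicalComplex.mkHomFromSingle (𝟙 _) fun j _ => by simp [hd]
  have h : ∑ i ∈ Finset.Icc a b, s i ≫ r i = 𝟙 K := by
    ext j
    have hf : (∑ i ∈ Finset.Icc a b, s i ≫ r i).f j =
        ∑ i ∈ Finset.Icc a b, (s i).f j ≫ (r i).f j :=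
      map_sum (HomologicalComplex.Hom.fAddMonoidHom j) _ _
    rw [hf]
    by_cases hj : j ∈ Finset.Icc a b
    · rw [Finset.sum_eq_single_of_mem j hj]
      · simp [s, r]
      · intro i _ hij
        exact (HomologicalComplex.isZero_single_obj_X (.up ℤ) i (K.X i) j hij.symm).eq_of_tgt
          ((s i).f j) 0 ▸ zero_comp
    · apply IsZero.eq_of_src
      rw [Finset.mem_Icc, not_and_or, not_le, not_le] at hj
      rcases hj with hj | hj
      · exact K.isZero_of_isStrictlyGE a j hj
      · exact K.isZero_of_isStrictlyLE b j hj
  refine boundedLayer_of_sum (bounded_Q_obj a b) (Finset.Icc a b) _ (fun i => (hK i).single i)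
    (fun i => Q.map (s i)) (fun i => Q.map (r i)) ?_
  have := congrArg Q.map h
  rw [Functor.map_sum, CategoryTheory.Functor.map_id] at this
  exact (Finset.sum_congr rfl fun i _ => (Q.map_comp (s i) (r i)).symm).trans this

/-- A bounded complex `K` is an extension of its complex of boundaries by its complex of cycles.
Both have zero differentials, and their terms are subobjects of terms of `K`. -/
lemma boundedLayer_Q_obj_of_mono {K : CochainComplex C ℤ} (a b : ℤ) [K.IsStrictlyGE a]
    [K.IsStrictlyLE b]
    (hK : ∀ (i : ℤ) (M : C) (f : M ⟶ K.X i) [Mono f],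
      boundedLayer T n ((singleFunctor C 0).obj M)) :
    boundedLayer T (2 * n + 1) (Q.obj K) := by
  let Z : CochainComplex C ℤ :=
    { X := fun i => kernel (K.d i (i + 1)), d := fun _ _ => 0 }
  let B : CochainComplex C ℤ :=
    { X := fun i => Abelian.image (K.d i (i + 1)), d := fun _ _ => 0 }
  let f : Z ⟶ K :=
    { f := fun i => kernel.ι (K.d i (i + 1))
      comm' := by rintro i j rfl; simp [Z] }
  let g : K ⟶ B :=
    { f := fun i => Abelian.factorThruImage (K.d i (i + 1))
      comm' := by
        rintro i j rfl
        rw [← cancel_mono (Abelian.image.ι (K.d (i + 1) (i + 1 + 1)))]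
        simp [B] }
  have hw : ∀ i, f.f i ≫ g.f i = 0 := fun i => by
    rw [← cancel_mono (Abelian.image.ι (K.d i (i + 1)))]
    simp [f, g]
  have w : f ≫ g = 0 := HomologicalComplex.hom_ext _ _ hw
  have h : (ShortComplex.mk f g w).ShortExact := by
    refine HomologicalComplex.shortExact_of_degreewise_shortExact _ fun i => ?_
    refine { exact := ?_
             mono_f := inferInstanceAs (Mono (kernel.ι (K.d i (i + 1))))
             epi_g := inferInstanceAs (Epi (Abelian.factorThruImage (K.d i (i + 1)))) }
    rw [ShortComplex.exact_iff_exact_up_to_refinements]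
    intro A (x : A ⟶ K.X i) (hx : x ≫ Abelian.factorThruImage (K.d i (i + 1)) = 0)
    refine ⟨A, 𝟙 A, inferInstance, kernel.lift _ x ?_, ?_⟩
    · have := hx =≫ Abelian.image.ι (K.d i (i + 1))
      rwa [Category.assoc, Abelian.image.fac, zero_comp] at this
    · exact (Category.id_comp _).trans (kernel.lift_ι _ _ _).symm
  have hZ : ∀ i, IsZero (K.X i) → IsZero (Z.X i) := fun i hi =>
    IsZero.of_mono (kernel.ι (K.d i (i + 1))) hi
  have hB : ∀ i, IsZero (K.X i) → IsZero (B.X i) := fun i hi =>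
    IsZero.of_epi (Abelian.factorThruImage (K.d i (i + 1))) hi
  have : Z.IsStrictlyGE a := (CochainComplex.isStrictlyGE_iff _ _).2 fun i hi =>
    hZ i (K.isZero_of_isStrictlyGE a i hi)
  have : Z.IsStrictlyLE b := (CochainComplex.isStrictlyLE_iff _ _).2 fun i hi =>
    hZ i (K.isZero_of_isStrictlyLE b i hi)
  have : B.IsStrictlyGE a := (CochainComplex.isStrictlyGE_iff _ _).2 fun i hi =>
    hB i (K.isZero_of_isStrictlyGE a i hi)
  have : B.IsStrictlyLE b := (CochainComplex.isStrictlyLE_iff _ _).2 fun i hi =>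
    hB i (K.isZero_of_isStrictlyLE b i hi)
  rw [two_mul]
  exact boundedLayer_of_distTriang (triangleOfSES_distinguished h)
    (boundedLayer_Q_obj_of_d_eq_zero a b (fun _ _ => rfl)
      fun i => hK i _ (kernel.ι (K.d i (i + 1))))
    (boundedLayer_Q_obj_of_d_eq_zero a b (fun _ _ => rfl)
      fun i => hK (i + 1) _ (Abelian.image.ι (K.d i (i + 1))))

/-- Let `S` be a class of objects that is closed under subobjects and binary biproducts, and such
that every object is a quotient of an object of `S`. Every bounded complex is the quotient of a
contractible bounded complex with terms in `S`, hence it is quasi-isomorphic to a shift of the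
kernel, which is a bounded complex with terms in `S`. -/
lemma exists_iso_shift_Q_obj {S : ObjectProperty C}
    (hsub : ∀ (X Y : C) (f : X ⟶ Y) [Mono f], S Y → S X)
    (hbiprod : ∀ X Y, S X → S Y → S (X ⊞ Y))
    (hepi : ∀ X : C, ∃ (F : C) (p : F ⟶ X), S F ∧ Epi p) {X : CochainComplex C ℤ} (a b : ℤ)
    [X.IsStrictlyGE a] [X.IsStrictlyLE b] :
    ∃ (K : CochainComplex C ℤ), K.IsStrictlyGE a ∧ K.IsStrictlyLE (b + 1) ∧
      (∀ i, S (K.X i)) ∧ Nonempty (Q.obj X ≅ (Q.obj K)⟦(1 : ℤ)⟧) := by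
  have hepi' : ∀ X : C, ∃ (F : C) (p : F ⟶ X), S F ∧ Epi p ∧ (IsZero X → IsZero F) := by
    intro X
    by_cases hX : IsZero X
    · obtain ⟨F, p, hF, -⟩ := hepi X
      have : Mono (0 : X ⟶ F) := ⟨fun _ _ _ => hX.eq_of_tgt _ _⟩
      exact ⟨X, 𝟙 X, hsub X F 0 hF, inferInstance, id⟩
    · obtain ⟨F, p, hF, hp⟩ := hepi X
      exact ⟨F, p, hF, hp, fun h => (hX h).elim⟩
  choose F p hF hp hF0 using hepi'
  -- `G` covers `X` by a cochain `α` of degree `-1`. Then `β = δ α` is a morphism `G ⟶ X`, which is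
  -- null-homotopic by construction, and `α` and `β` define `π : cone (𝟙 G) ⟶ X`.
  let G : CochainComplex C ℤ :=
    { X := fun i => F (X.X (i - 1)), d := fun _ _ => 0 }
  let α : CochainComplex.HomComplex.Cochain G X (-1) := .mk fun i j h =>
    p (X.X (i - 1)) ≫ (X.XIsoOfEq (by omega)).hom
  let z : CochainComplex.HomComplex.Cocycle G X 0 :=
    ⟨CochainComplex.HomComplex.δ (-1) 0 α, by
      rw [CochainComplex.HomComplex.Cocycle.mem_iff 0 1 (zero_add 1), CochainComplex.HomComplex.δ_δ]⟩
  let β : G ⟶ X := CochainComplex.HomComplex.Cocycle.homOf z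
  have hβ : CochainComplex.HomComplex.δ (-1) 0 α =
      CochainComplex.HomComplex.Cochain.ofHom (𝟙 G ≫ β) := by
    rw [Category.id_comp]
    exact (CochainComplex.HomComplex.Cocycle.cochain_ofHom_homOf_eq_coe z).symm
  let π : CochainComplex.mappingCone (𝟙 G) ⟶ X := CochainComplex.mappingCone.desc (𝟙 G) α β hβ
  have hπ : ∀ i, Epi (π.f i) := by
    intro i
    have h := CochainComplex.mappingCone.inl_v_desc_f (𝟙 G) α β hβ (i + 1) i (by omega)
    have : Epi (α.v (i + 1) i (by omega)) := by
      have := hp (X.X (i + 1 - 1))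
      exact epi_comp _ _
    exact epi_of_epi_fac h
  have : Epi π := HomologicalComplex.epi_of_epi_f _ hπ
  have hw := kernel.condition π
  have hK : (ShortComplex.mk (kernel.ι π) π hw).ShortExact :=
    { exact := ShortComplex.exact_kernel π
      mono_f := inferInstanceAs (Mono (kernel.ι π))
      epi_g := this }
  let m : ∀ i, (kernel π).X i ⟶ G.X (i + 1) ⊞ G.X i := fun i => (kernel.ι π).f i ≫
    biprod.lift ((CochainComplex.mappingCone.fst (𝟙 G)).1.v i (i + 1) rfl)
      ((CochainComplex.mappingCone.snd (𝟙 G)).v i i (add_zero i))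
  have hm : ∀ i, Mono (m i) := by
    intro i
    have : Mono (biprod.lift ((CochainComplex.mappingCone.fst (𝟙 G)).1.v i (i + 1) rfl)
        ((CochainComplex.mappingCone.snd (𝟙 G)).v i i (add_zero i))) := by
      rw [Preadditive.mono_iff_cancel_zero]
      intro A x hx
      apply (CochainComplex.mappingCone.ext_to_iff (𝟙 G) i (i + 1) rfl x 0).2
      constructor
      · simpa using hx =≫ biprod.fst
      · simpa using hx =≫ biprod.snd
    exact mono_comp _ _
  have hG : ∀ i, IsZero (X.X (i - 1)) → IsZero (G.X i) := fun i hi => hF0 _ hi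
  have hzero : ∀ i, IsZero (X.X i) → IsZero (X.X (i - 1)) → IsZero ((kernel π).X i) := by
    intro i hi hi'
    have h1 : IsZero (G.X (i + 1)) := hG _ (by rwa [add_sub_cancel_right])
    have h2 : IsZero (G.X i) := hG _ hi'
    refine IsZero.of_mono (m i) ?_
    exact (biprod_isZero_iff _ _).2 ⟨h1, h2⟩
  refine ⟨kernel π, (CochainComplex.isStrictlyGE_iff _ _).2 fun i hi => ?_,
    (CochainComplex.isStrictlyLE_iff _ _).2 fun i hi => ?_, fun i => ?_, ?_⟩
  · exact hzero i (X.isZero_of_isStrictlyGE a i) (X.isZero_of_isStrictlyGE a (i - 1))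
  · exact hzero i (X.isZero_of_isStrictlyLE b i) (X.isZero_of_isStrictlyLE b (i - 1))
  · exact hsub _ _ (m i) (hbiprod _ _ (hF _) (hF _))
  · have h0 : IsZero (Q.obj (CochainComplex.mappingCone (𝟙 G))) :=
      (Triangle.isZero₃_iff_isIso₁ _ (mappingCone_triangle_distinguished (𝟙 G))).2
        (inferInstanceAs (IsIso (Q.map (𝟙 G))))
    have : IsIso (triangleOfSES hK).mor₃ :=
      (Triangle.isZero₂_iff_isIso₃ _ (triangleOfSES_distinguished hK)).1 h0
    exact ⟨@asIso _ _ _ _ (triangleOfSES hK).mor₃ this⟩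

/-- If a class `S` as in `exists_iso_shift_Q_obj` is contained in `[T]ₙ₊₁`, then the bounded
derived category is `⟨T⟩₂ₙ₊₂`. -/
lemma triangEnvelopeIter_boundedSingle_eq_top {S : ObjectProperty C}
    (hsub : ∀ (X Y : C) (f : X ⟶ Y) [Mono f], S Y → S X)
    (hbiprod : ∀ X Y, S X → S Y → S (X ⊞ Y))
    (hepi : ∀ X : C, ∃ (F : C) (p : F ⟶ X), S F ∧ Epi p)
    (hS : S ≤ extLayer (.singleton T) (n + 1)) :
    (ObjectProperty.singleton (boundedSingle T)).triangEnvelopeIter (2 * n + 1) = ⊤ := by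
  refine top_le_iff.1 fun X _ => ?_
  obtain ⟨X, ⟨⟨a, ha⟩, ⟨b, hb⟩⟩⟩ := X
  obtain ⟨X', _, _, ⟨e⟩⟩ := X.exists_iso_Q_obj_of_isGE_of_isLE a b
  obtain ⟨K, _, _, hK, ⟨e'⟩⟩ := exists_iso_shift_Q_obj hsub hbiprod hepi (X := X') a b
  have hK' : boundedLayer T (2 * n + 1) (Q.obj K) :=
    boundedLayer_Q_obj_of_mono a (b + 1) fun i M f _ =>
      boundedLayer_of_extLayer (hS _ (hsub _ _ f (hK i)))
  exact ((hK'.shift 1).of_iso (e ≪≫ e')).2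

end Derived

/-! ### Injective hulls -/

section InjectiveHull

variable {Λ : Type u} [Ring Λ]

lemma exists_maximal_disjoint {M : Type*} [AddCommGroup M] [Module Λ M] {A B : Submodule Λ M}
    (h : Disjoint A B) : ∃ C, A ≤ C ∧ Disjoint C B ∧ ∀ D, C ≤ D → Disjoint D B → D = C := by
  obtain ⟨C, hAC, hC⟩ := zorn_le_nonempty₀ {C : Submodule Λ M | Disjoint C B}
    (fun c hc hchain y hy => ⟨sSup c, (DirectedOn.disjoint_sSup_left hchain.directedOn).2
      fun _ hb => hc hb, fun _ hz => le_sSup hz⟩) A h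
  exact ⟨C, hAC, hC.prop, fun D hD hD' => le_antisymm (hC.le_of_ge hD' hD) hD⟩

/-- Every submodule of an injective module is contained in an essential extension that is
injective. -/
lemma exists_injective_essential {I : Type u} [AddCommGroup I] [Module Λ I] [Module.Injective Λ I]
    (B : Submodule Λ I) : ∃ E : Submodule Λ I, B ≤ E ∧ Module.Injective Λ E ∧
      ∀ D ≤ E, Disjoint D B → D = ⊥ := by
  -- `C` is a complement of `B`, and `E` is a complement of `C` that contains `B`.
  obtain ⟨C, -, hCB, hC⟩ := exists_maximal_disjoint (disjoint_bot_left (a := B))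
  obtain ⟨E, hBE, hEC, hE⟩ := exists_maximal_disjoint hCB.symm
  have hess : ∀ D ≤ E, Disjoint D B → D = ⊥ := by
    intro D hD hDB
    have h : Disjoint (C ⊔ D) B :=
      hDB.disjoint_sup_left_of_disjoint_sup_right (hEC.symm.mono_right (sup_le hD hBE))
    have hDC : D ≤ C := (hC _ le_sup_left h) ▸ le_sup_right
    exact eq_bot_iff.2 (hEC hD hDC)
  -- The inclusion of `E ≃ (E ⊕ C) / C` extends to a map `I / C → I`.
  have hinj : Function.Injective (C.mkQ ∘ₗ E.subtype) := by
    rw [← LinearMap.ker_eq_bot, LinearMap.ker_comp, Submodule.ker_mkQ]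
    exact Submodule.disjoint_iff_comap_eq_bot.1 hEC
  obtain ⟨h, hh⟩ := Module.Injective.out (C.mkQ ∘ₗ E.subtype) hinj E.subtype
  let p : I →ₗ[Λ] I := h ∘ₗ C.mkQ
  have hpE : ∀ e ∈ E, p e = e := fun e he => hh ⟨e, he⟩
  have hCp : C ≤ LinearMap.ker p := by
    intro c hc
    have : C.mkQ c = 0 := by simpa using hc
    simp [p, this]
  -- A submodule containing `C` that meets `E` trivially is equal to `C`.
  have hEq : ∀ N : Submodule Λ I, C ≤ N → Disjoint N E → N = C := fun N hN hNE =>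
    hC N hN (hNE.mono_right hBE)
  have hrange : LinearMap.range p = E := by
    refine hE _ (fun e he => ⟨e, hpE e he⟩) ?_
    have hker : (C ⊓ LinearMap.range p).comap p = C := by
      refine hEq _ (fun c hc => ?_) ?_
      · have : p c = 0 := hCp hc
        simp [this]
      · rw [Submodule.disjoint_def]
        intro e he heE
        have h1 : p e ∈ C := he.1
        rw [hpE e heE] at h1
        exact Submodule.disjoint_def.1 hEC e heE h1
    rw [Submodule.disjoint_def]
    rintro _ ⟨x, rfl⟩ hx
    have : x ∈ C := hker ▸ (⟨hx, x, rfl⟩ : p x ∈ C ⊓ LinearMap.range p)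
    exact hCp this
  refine ⟨E, hBE, ⟨fun X Y _ _ _ _ f hf g => ?_⟩, hess⟩
  obtain ⟨g', hg'⟩ := Module.Injective.out f hf (E.subtype ∘ₗ g)
  refine ⟨(p.codRestrict E fun x => hrange ▸ ⟨x, rfl⟩) ∘ₗ g', fun x => Subtype.ext ?_⟩
  change p (g' (f x)) = g x
  rw [hg']
  exact hpE _ (g x).2

end InjectiveHull

/-! ### Modules over artin algebras -/

section ArtinAlgebra

variable {Λ : Type u} [Ring Λ]

/-- The submodule of the elements that are annihilated by the Jacobson radical. -/
def radicalTorsion (Λ : Type u) [Ring Λ] (M : Type*) [AddCommGroup M] [Module Λ M] :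
    Submodule Λ M where
  carrier := {x | ∀ j ∈ Ring.jacobson Λ, j • x = 0}
  zero_mem' := by simp
  add_mem' hx hy j hj := by rw [smul_add, hx j hj, hy j hj, add_zero]
  smul_mem' c x hx j hj := by
    rw [← mul_smul]
    exact hx _ (Ideal.mul_mem_right c _ hj)

/-- If the radical is nilpotent, then every nonzero submodule contains a nonzero element that is
annihilated by the radical. -/
lemma eq_bot_of_disjoint_radicalTorsion [IsSemiprimaryRing Λ] {M : Type*} [AddCommGroup M]
    [Module Λ M] {K : Submodule Λ M} (h : Disjoint K (radicalTorsion Λ M)) : K = ⊥ := by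
  obtain ⟨N, hN⟩ := IsSemiprimaryRing.isNilpotent (R := Λ)
  have key : ∀ i, ∀ x ∈ K, (∀ r ∈ (Ring.jacobson Λ) ^ i, r • x = 0) → x = 0 := by
    intro i
    induction i with
    | zero =>
      intro x _ hx
      rw [← one_smul Λ x]
      exact hx 1 (by rw [Submodule.pow_zero, Ideal.one_eq_top]; trivial)
    | succ i ih =>
      intro x hxK hx
      refine Submodule.disjoint_def.1 h _ hxK fun j hj => ih _ (K.smul_mem j hxK) fun r hr => ?_
      rw [← mul_smul]
      refine hx _ ?_
      rw [Submodule.pow_succ]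
      exact Submodule.mul_mem_mul hr hj
  rw [Submodule.eq_bot_iff]
  intro x hx
  refine key N x hx fun r hr => ?_
  rw [hN] at hr
  rw [show r = 0 from hr, zero_smul]

instance isSemisimpleModule_quotient_jacobson [IsSemiprimaryRing Λ] :
    IsSemisimpleModule Λ (Λ ⧸ Ring.jacobson Λ) :=
  (LinearMap.isSemisimpleModule_iff_of_bijective
    (σ := Ideal.Quotient.mk (Ring.jacobson Λ))
    { toFun := id, map_add' := fun _ _ => rfl, map_smul' := fun _ _ => rfl }
    Function.bijective_id).2 inferInstance

/-- A finitely generated module that is annihilated by the radical is a direct summand of a finite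
direct power of `Λ / rad Λ`. -/
lemma exists_retract_of_radicalTorsion [IsSemiprimaryRing Λ] {M : Type*} [AddCommGroup M]
    [Module Λ M] [Module.Finite Λ M] (h : radicalTorsion Λ M = ⊤) :
    ∃ (n : ℕ) (i : M →ₗ[Λ] Fin n → Λ ⧸ Ring.jacobson Λ)
      (p : (Fin n → Λ ⧸ Ring.jacobson Λ) →ₗ[Λ] M), p ∘ₗ i = LinearMap.id := by
  obtain ⟨n, m, hm⟩ := Module.Finite.exists_fin (R := Λ) (M := M)
  let p : (Fin n → Λ ⧸ Ring.jacobson Λ) →ₗ[Λ] M := ∑ k, ((Ring.jacobson Λ).liftQ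
    (LinearMap.toSpanSingleton Λ M (m k)) (fun j hj => by
      have : m k ∈ radicalTorsion Λ M := h ▸ Submodule.mem_top
      exact this j hj)) ∘ₗ LinearMap.proj k
  have hp : Function.Surjective p := by
    rw [← LinearMap.range_eq_top, eq_top_iff, ← hm, Submodule.span_le]
    rintro _ ⟨k, rfl⟩
    refine ⟨Pi.single k (Submodule.Quotient.mk 1), ?_⟩
    simp only [p, LinearMap.sum_apply, LinearMap.comp_apply, LinearMap.proj_apply]
    rw [Finset.sum_eq_single_of_mem k (Finset.mem_univ k)]
    · rw [Pi.single_eq_same]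
      exact one_smul Λ (m k)
    · intro l _ hl
      rw [Pi.single_eq_of_ne hl, map_zero]
  obtain ⟨i, hi⟩ := IsSemisimpleModule.lifting_property p hp LinearMap.id
  exact ⟨n, i, p, hi⟩

/-- A module over an artin algebra is finitely generated if its submodule of elements annihilated
by the radical is. -/
lemma finite_of_fg_radicalTorsion (R : Type*) [CommRing R] [IsArtinianRing R] [Algebra R Λ]
    [Module.Finite R Λ] {E : Type*} [AddCommGroup E] [Module Λ E]
    (h : (radicalTorsion Λ E).FG) : Module.Finite Λ E := by
  let : Module R E := Module.compHom E (algebraMap R Λ)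
  have : IsScalarTower R Λ E := .of_algebraMap_smul fun _ _ => rfl
  have : IsArtinianRing Λ := IsArtinianRing.of_finite R Λ
  have hS : ((radicalTorsion Λ E).restrictScalars R).FG := by
    have : Module.Finite Λ (radicalTorsion Λ E) := Module.Finite.iff_fg.2 h
    exact Module.Finite.iff_fg.1 (Module.Finite.trans (R := R) Λ (radicalTorsion Λ E))
  obtain ⟨N, hN⟩ := IsSemiprimaryRing.isNilpotent (R := Λ)
  -- `L i` is the submodule of the elements annihilated by the `i`-th power of the radical.
  let L : ℕ → Submodule R E := fun i =>
    { carrier := {x | ∀ r ∈ (Ring.jacobson Λ) ^ i, r • x = 0}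
      zero_mem' := by simp
      add_mem' := fun hx hy r hr => by rw [smul_add, hx r hr, hy r hr, add_zero]
      smul_mem' := fun c x hx r hr => by rw [smul_comm, hx r hr, smul_zero] }
  have hL : ∀ i, (L i).FG := by
    intro i
    induction i with
    | zero =>
      have : L 0 = ⊥ := by
        rw [Submodule.eq_bot_iff]
        intro x hx
        rw [← one_smul Λ x]
        exact hx 1 (by rw [Submodule.pow_zero, Ideal.one_eq_top]; trivial)
      rw [this]
      exact Submodule.fg_bot
    | succ i ih =>
      -- If `t` generates the radical, then `x ↦ (r • x)_{r ∈ t}` maps `L (i + 1)` to tuples of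
      -- elements of `L i`, and its kernel consists of the elements annihilated by the radical.
      obtain ⟨t, ht⟩ : (Ring.jacobson Λ).FG := IsNoetherian.noetherian _
      let f : E →ₗ[R] (t → E) := LinearMap.pi fun r =>
        { toFun := fun x => (r : Λ) • x
          map_add' := smul_add _
          map_smul' := fun c x => smul_comm _ _ _ }
      refine Submodule.fg_of_fg_map_of_fg_inf_ker f ?_ ?_
      · refine Submodule.FG.of_le (Submodule.fg_pi fun _ : t => ih) ?_
        rintro _ ⟨x, hx, rfl⟩ j - r hr
        have hj : (j : Λ) ∈ Ring.jacobson Λ := ht ▸ Submodule.subset_span j.2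
        change r • (j : Λ) • x = 0
        rw [← mul_smul]
        refine hx _ ?_
        rw [Submodule.pow_succ]
        exact Submodule.mul_mem_mul hr hj
      · refine Submodule.FG.of_le hS ?_
        rintro x ⟨-, hx⟩ j hj
        have hle : Ring.jacobson Λ ≤ LinearMap.ker (LinearMap.toSpanSingleton Λ E x) := by
          rw [← ht, Submodule.span_le]
          exact fun r hr => congrFun hx ⟨r, hr⟩
        exact hle hj
  have hLN : L N = ⊤ := by
    rw [eq_top_iff]
    intro x _ r hr
    rw [hN] at hr
    rw [show r = 0 from hr, zero_smul]
  have : Module.Finite R E := ⟨hLN ▸ hL N⟩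
  exact Module.Finite.of_restrictScalars_finite R Λ E

/-- Over an artin algebra, there is a finitely generated injective module `E` such that every
finitely generated module embeds in a finite direct power of `E`. -/
lemma exists_finite_injective_cogenerator (R : Type*) [CommRing R] [IsArtinianRing R] (Λ : Type u)
    [Ring Λ] [Algebra R Λ] [Module.Finite R Λ] :
    ∃ (E : Type u) (_ : AddCommGroup E) (_ : Module Λ E), Module.Injective Λ E ∧
      Module.Finite Λ E ∧ ∀ (M : Type u) [AddCommGroup M] [Module Λ M] [Module.Finite Λ M],
        ∃ (n : ℕ) (f : M →ₗ[Λ] Fin n → E), Function.Injective f := by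
  have : IsArtinianRing Λ := IsArtinianRing.of_finite R Λ
  obtain ⟨J, hJ, f, hf⟩ := (EnoughInjectives.presentation
    (ModuleCat.of Λ (Λ ⧸ Ring.jacobson Λ))).some
  have : Module.Injective Λ J := Module.injective_module_of_injective_object Λ J
  have hf' : Function.Injective f.hom := (ModuleCat.mono_iff_injective f).1 hf
  obtain ⟨E, hBE, hE, hess⟩ := exists_injective_essential (LinearMap.range f.hom)
  have hfE : ∀ x, f.hom x ∈ E := fun x => hBE ⟨x, rfl⟩
  -- The submodule of `E` annihilated by the radical is the copy of `Λ / rad Λ`.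
  have htor : (radicalTorsion Λ E).FG := by
    have hle : radicalTorsion Λ E ≤ LinearMap.range (f.hom.codRestrict E hfE) := by
      intro x hx
      -- `Λ x` is semisimple, and a complement of `Λ x ∩ B` is zero since `E` is essential over `B`.
      let g : (Λ ⧸ Ring.jacobson Λ) →ₗ[Λ] J :=
        (Ring.jacobson Λ).liftQ (LinearMap.toSpanSingleton Λ J x) fun j hj =>
          congrArg Subtype.val (hx j hj)
      have hgE : LinearMap.range g ≤ E := by
        rintro _ ⟨y, rfl⟩
        obtain ⟨y, rfl⟩ := Submodule.Quotient.mk_surjective _ y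
        exact E.smul_mem y x.2
      obtain ⟨D, hD⟩ := exists_isCompl ((LinearMap.range f.hom).comap g)
      have hD0 : D.map g = ⊥ := by
        refine hess _ (LinearMap.map_le_range.trans hgE) ?_
        rw [Submodule.disjoint_def]
        rintro _ ⟨y, hy, rfl⟩ hy'
        rw [Submodule.disjoint_def.1 hD.disjoint y hy' hy, map_zero]
      have hDle : D ≤ (LinearMap.range f.hom).comap g := fun y hy => by
        have : g y ∈ D.map g := ⟨y, hy, rfl⟩
        rw [hD0, Submodule.mem_bot] at this
        rw [Submodule.mem_comap, this]
        exact Submodule.zero_mem _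
      have htop : (LinearMap.range f.hom).comap g = ⊤ := by
        rw [← hD.sup_eq_top, left_eq_sup]
        exact hDle
      have h1 : g (Submodule.Quotient.mk 1) = x := one_smul Λ (x : J)
      have h2 : g (Submodule.Quotient.mk 1) ∈ LinearMap.range f.hom :=
        htop.ge (Submodule.mem_top : (Submodule.Quotient.mk 1 : Λ ⧸ Ring.jacobson Λ) ∈ ⊤)
      obtain ⟨y, hy⟩ := h2
      exact ⟨y, Subtype.ext (hy.trans h1)⟩
    exact Submodule.FG.of_le (Module.Finite.iff_fg.1 inferInstance) hle
  refine ⟨E, inferInstance, inferInstance, hE, finite_of_fg_radicalTorsion R htor, ?_⟩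
  intro M _ _ _
  obtain ⟨n, i, p, hpi⟩ := exists_retract_of_radicalTorsion
    (Λ := Λ) (M := radicalTorsion Λ M) (by
      rw [eq_top_iff]
      rintro x - j hj
      exact Subtype.ext (x.2 j hj))
  have hi : Function.Injective i := Function.LeftInverse.injective (g := p)
    fun x => LinearMap.congr_fun hpi x
  have hext : ∀ k, ∃ g : M →ₗ[Λ] E, ∀ x : radicalTorsion Λ M,
      g x = f.hom.codRestrict E hfE (i x k) := fun k =>
    hE.out (radicalTorsion Λ M).subtype Subtype.val_injective
      (f.hom.codRestrict E hfE ∘ₗ (LinearMap.proj k : (Fin n → Λ ⧸ Ring.jacobson Λ) →ₗ[Λ] _) ∘ₗ i)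
  choose g hg using hext
  refine ⟨n, LinearMap.pi g, LinearMap.ker_eq_bot.1 (eq_bot_of_disjoint_radicalTorsion ?_)⟩
  rw [Submodule.disjoint_def]
  intro x hx hx'
  have h0 : i ⟨x, hx'⟩ = 0 := by
    funext k
    apply hf'
    have h1 : g k x = 0 := congrFun hx k
    rw [hg k ⟨x, hx'⟩] at h1
    simpa using congrArg Subtype.val h1
  have := hi (h0.trans i.map_zero.symm)
  exact congrArg Subtype.val this

end ArtinAlgebra

/-! ### Finitely generated modules -/

section FGModuleCat

variable {Λ : Type u} [Ring Λ]

lemma retract_of_comp_eq_id {M N : FGModuleCat.{u} Λ} (i : M →ₗ[Λ] N) (p : N →ₗ[Λ] M)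
    (h : p ∘ₗ i = LinearMap.id) : Nonempty (Retract M N) :=
  ⟨⟨FGModuleCat.ofHom i, FGModuleCat.ofHom p, FGModuleCat.hom_ext h⟩⟩

variable [IsNoetherianRing Λ]

lemma FGModuleCat.mono_iff_injective {M N : FGModuleCat.{u} Λ} (f : M ⟶ N) :
    Mono f ↔ Function.Injective f.hom.hom := by
  rw [← ModuleCat.mono_iff_injective]
  exact ((forget₂ (FGModuleCat.{u} Λ) (ModuleCat.{u} Λ)).mono_map_iff_mono f).symm

lemma FGModuleCat.epi_iff_surjective {M N : FGModuleCat.{u} Λ} (f : M ⟶ N) :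
    Epi f ↔ Function.Surjective f.hom.hom := by
  rw [← ModuleCat.epi_iff_surjective]
  exact ((forget₂ (FGModuleCat.{u} Λ) (ModuleCat.{u} Λ)).epi_map_iff_epi f).symm

lemma FGModuleCat.shortExact_iff (S : ShortComplex (FGModuleCat.{u} Λ)) :
    S.ShortExact ↔ Function.Injective S.f.hom.hom ∧ Function.Exact S.f.hom.hom S.g.hom.hom ∧
      Function.Surjective S.g.hom.hom := by
  have : S.Exact ↔ Function.Exact S.f.hom.hom S.g.hom.hom := by
    have : (forget₂ (FGModuleCat.{u} Λ) (ModuleCat.{u} Λ)).Additive := ⟨rfl⟩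
    rw [← S.exact_map_iff_of_faithful (forget₂ (FGModuleCat.{u} Λ) (ModuleCat.{u} Λ)),
      ShortComplex.ShortExact.moduleCat_exact_iff_function_exact]
    rfl
  rw [← FGModuleCat.mono_iff_injective, ← FGModuleCat.epi_iff_surjective, ← this]
  exact ⟨fun h => ⟨h.mono_f, h.exact, h.epi_g⟩,
    fun h => { exact := h.2.1, mono_f := h.1, epi_g := h.2.2 }⟩

/-- The short exact sequence of a submodule and its quotient. -/
lemma FGModuleCat.shortExact_quotient (M : Type u) [AddCommGroup M] [Module Λ M]
    [Module.Finite Λ M] (N : Submodule Λ M) :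
    (ShortComplex.mk (FGModuleCat.ofHom N.subtype) (FGModuleCat.ofHom N.mkQ)
      (FGModuleCat.hom_ext (LinearMap.ext fun x =>
        (Submodule.Quotient.mk_eq_zero N).2 x.2))).ShortExact :=
  (FGModuleCat.shortExact_iff _).2 ⟨N.subtype_injective,
    LinearMap.exact_subtype_mkQ N, N.mkQ_surjective⟩

/-- Finite direct powers of `M` lie in `add M`. -/
lemma addClosure_of_pi (M : Type u) [AddCommGroup M] [Module Λ M] [Module.Finite Λ M] (n : ℕ) :
    addClosure (.singleton (FGModuleCat.of Λ M)) (FGModuleCat.of Λ (Fin n → M)) := by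
  refine addClosure_of_sum (fun _ : Fin n => FGModuleCat.of Λ M) (fun _ => by simp)
    (fun i => FGModuleCat.ofHom (LinearMap.proj i))
    (fun i => FGModuleCat.ofHom (LinearMap.single Λ (fun _ => M) i)) ?_
  refine FGModuleCat.hom_ext (LinearMap.ext fun x => ?_)
  have h : ∀ (s : Finset (Fin n)) (F : Fin n → (FGModuleCat.of Λ (Fin n → M) ⟶
      FGModuleCat.of Λ (Fin n → M))), (∑ i ∈ s, F i).hom.hom x = ∑ i ∈ s, (F i).hom.hom x := by
    intro s F
    induction s using Finset.cons_induction with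
    | empty => simp
    | cons a s ha ih => rw [Finset.sum_cons, Finset.sum_cons, ← ih]; rfl
  exact (h _ _).trans (LinearMap.sum_single_apply (fun _ => M) x)

/-- A finitely generated module over a left artinian ring is a finite direct sum of indecomposable
modules. -/
lemma addClosure_indecomposable [IsArtinianRing Λ] (M : FGModuleCat.{u} Λ) :
    addClosure (fun X : FGModuleCat.{u} Λ => IsIndecomposableModule Λ X) M := by
  -- Artinian induction on submodules: a decomposable `N` is the sum of two smaller ones.
  have key : ∀ N : Submodule Λ M,
      addClosure (fun X : FGModuleCat.{u} Λ => IsIndecomposableModule Λ X) (.of Λ N) := by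
    intro N
    induction N using WellFoundedLT.induction with
    | ind N ih =>
    by_cases hN : IsIndecomposableModule Λ N
    · exact le_addClosure _ _ hN
    by_cases hN' : Nontrivial N
    · obtain ⟨A, B, hAB, hA, hB⟩ : ∃ A B : Submodule Λ N, IsCompl A B ∧ A ≠ ⊥ ∧ B ≠ ⊥ := by
        by_contra! h
        exact hN ⟨hN', fun A B hAB => or_iff_not_imp_left.2 fun hA => h A B hAB hA⟩
      have hlt : ∀ A : Submodule Λ N, A ≠ ⊤ → A.map N.subtype < N := fun A hA =>
        lt_of_le_of_ne (Submodule.map_subtype_le N A) fun h => hA <| by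
          rw [← Submodule.comap_map_eq_of_injective N.subtype_injective A, h,
            Submodule.comap_subtype_self]
      have hA' : A ≠ ⊤ := by
        rintro rfl
        exact hB (by simpa using hAB.inf_eq_bot)
      have hB' : B ≠ ⊤ := by
        rintro rfl
        exact hA (by simpa using hAB.inf_eq_bot)
      have ha := ih _ (hlt A hA')
      have hb := ih _ (hlt B hB')
      let eA := A.equivMapOfInjective N.subtype N.subtype_injective
      let eB := B.equivMapOfInjective N.subtype N.subtype_injective
      refine ha.of_add hb
        (FGModuleCat.ofHom (eA.toLinearMap ∘ₗ A.projectionOnto B hAB))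
        (FGModuleCat.ofHom (A.subtype ∘ₗ eA.symm.toLinearMap))
        (FGModuleCat.ofHom (eB.toLinearMap ∘ₗ B.projectionOnto A hAB.symm))
        (FGModuleCat.ofHom (B.subtype ∘ₗ eB.symm.toLinearMap)) ?_
      refine FGModuleCat.hom_ext (LinearMap.ext fun x => ?_)
      change ((eA.symm (eA (A.projectionOnto B hAB x)) : A) : N) +
        ((eB.symm (eB (B.projectionOnto A hAB.symm x)) : B) : N) = x
      simp only [LinearEquiv.symm_apply_apply]
      exact Submodule.projection_add_projection_eq_self hAB x
    · have := not_nontrivial_iff_subsingleton.1 hN'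
      refine addClosure_of_isZero _ ((IsZero.iff_id_eq_zero _).2 (FGModuleCat.hom_ext
        (LinearMap.ext fun x => Subsingleton.elim (α := N) _ _)))
  exact (key ⊤).of_iso (LinearEquiv.toFGModuleCatIso (Submodule.topEquiv (R := Λ) (M := M))).symm

/-- Over a representation-finite left artinian ring, every finitely generated module lies in
`add T` for a fixed `T`. -/
lemma exists_addClosure_eq_top [IsArtinianRing Λ] (h : IsRepresentationFinite Λ) :
    ∃ T : FGModuleCat.{u} Λ, ∀ X, addClosure (.singleton T) X := by
  obtain ⟨n, M, hM⟩ := h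
  refine ⟨.of Λ (∀ i, M i), fun X => addClosure_le_of_le ?_ X (addClosure_indecomposable X)⟩
  intro Y hY
  obtain ⟨i, ⟨e⟩⟩ := hM Y hY
  obtain ⟨ρ⟩ := retract_of_comp_eq_id (M := Y) (N := .of Λ (∀ i, M i))
    (LinearMap.single Λ (fun i => M i) i ∘ₗ e.toLinearMap)
    (e.symm.toLinearMap ∘ₗ LinearMap.proj i) (by ext x; simp)
  exact (addClosure_singleton_self _).of_retract ρ

end FGModuleCat

/-! ### Torsionless modules and left idealized extensions -/

section Torsionless

/-- The torsionless modules: the modules that embed in a finitely generated free module. -/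
def IsTorsionless (Λ : Type u) [Ring Λ] : ObjectProperty (FGModuleCat.{u} Λ) := fun M =>
  ∃ (n : ℕ) (f : M →ₗ[Λ] Fin n → Λ), Function.Injective f

section

variable {R Λ Γ : Type u} [CommRing R] [Ring Λ] [Algebra R Λ] [Ring Γ] [Algebra R Γ]
  [Module.Finite R Γ]

/-- Restriction along `Λ → Γ` preserves finite generation because `Γ` is finitely generated over
the common base ring `R`. -/
lemma finite_restrictScalars (φ : Λ →ₐ[R] Γ) (M : ModuleCat.{u} Γ) [Module.Finite Γ M] :
    Module.Finite Λ ((ModuleCat.restrictScalars φ.toRingHom).obj M) := by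
  let _ : Module Λ Γ := Module.compHom Γ φ.toRingHom
  let _ : Module Λ M := Module.compHom M φ.toRingHom
  have : IsScalarTower R Λ Γ := ⟨fun r a x => by
    change φ (r • a) * x = r • (φ a * x)
    rw [map_smul, smul_mul_assoc]⟩
  have : IsScalarTower Λ Γ M := ⟨fun a x m => mul_smul (φ a) x m⟩
  have : Module.Finite Λ Γ := Module.Finite.of_restrictScalars_finite R Λ Γ
  exact Module.Finite.trans (R := Λ) Γ M

/-- Restriction of scalars for finitely generated modules. -/
noncomputable def restrictScalarsFG (φ : Λ →ₐ[R] Γ) : FGModuleCat.{u} Γ ⥤ FGModuleCat.{u} Λ :=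
  (ModuleCat.isFG Λ).lift ((ModuleCat.isFG Γ).ι ⋙ ModuleCat.restrictScalars φ.toRingHom) fun M =>
    have : Module.Finite Γ M.obj := M.property
    finite_restrictScalars φ M.obj

instance (φ : Λ →ₐ[R] Γ) : (restrictScalarsFG φ).Additive := ⟨rfl⟩

lemma restrictScalarsFG_shortExact [IsNoetherianRing Λ] [IsNoetherianRing Γ] (φ : Λ →ₐ[R] Γ)
    (S : ShortComplex (FGModuleCat.{u} Γ)) (hS : S.ShortExact) :
    (S.map (restrictScalarsFG φ)).ShortExact :=
  (FGModuleCat.shortExact_iff _).2 ((FGModuleCat.shortExact_iff S).1 hS)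

/-- Let `Γ` be a left idealized extension of `Λ`. If `X` embeds in `Λⁿ`, then the image of
`rad Λ • X` in `Γⁿ` is a `Γ`-submodule: `γ (j x) = (γ j) x` and `γ j` lies in `rad Λ`. Hence
`rad Λ • X` is the restriction of a torsionless `Γ`-module. -/
lemma exists_iso_restrictScalarsFG [IsNoetherianRing Λ] [IsNoetherianRing Γ] {φ : Λ →ₐ[R] Γ}
    (hφ : IsLeftIdealizedExtension φ) {X : FGModuleCat.{u} Λ} (hX : IsTorsionless Λ X) :
    ∃ Y : FGModuleCat.{u} Γ, IsTorsionless Γ Y ∧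
      Nonempty (FGModuleCat.of Λ (Ring.jacobson Λ • (⊤ : Submodule Λ X) : Submodule Λ X) ≅
        (restrictScalarsFG φ).obj Y) := by
  obtain ⟨n, f, hf⟩ := hX
  obtain ⟨hinj, I, hI⟩ := hφ
  let ψ : X → Fin n → Γ := fun x i => φ (f x i)
  have ψ_add : ∀ x y, ψ (x + y) = ψ x + ψ y := fun x y => by ext i; simp [ψ]
  have ψ_zero : ψ 0 = 0 := by ext i; simp [ψ]
  have ψ_smul : ∀ (a : Λ) x, ψ (a • x) = φ a • ψ x := fun a x => by ext i; simp [ψ]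
  have ψ_inj : Function.Injective ψ := fun x y h =>
    hf (funext fun i => hinj (congrFun h i))
  let N : Submodule Γ (Fin n → Γ) :=
    { carrier := ψ '' (Ring.jacobson Λ • (⊤ : Submodule Λ X) : Submodule Λ X)
      add_mem' := by
        rintro _ _ ⟨x, hx, rfl⟩ ⟨y, hy, rfl⟩
        exact ⟨x + y, add_mem hx hy, ψ_add x y⟩
      zero_mem' := ⟨0, zero_mem _, ψ_zero⟩
      smul_mem' := by
        rintro γ _ ⟨x, hx, rfl⟩
        refine Submodule.smul_induction_on hx (fun j hj m _ => ?_) fun x y hx hy => ?_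
        · have hmem : γ * φ j ∈ I :=
            I.mul_mem_left γ (hI.symm.subset (Set.mem_image_of_mem φ hj))
          obtain ⟨j', hj', h⟩ := hI.subset hmem
          refine ⟨j' • m, Submodule.smul_mem_smul hj' trivial, ?_⟩
          rw [ψ_smul, ψ_smul, h, mul_smul]
        · obtain ⟨x', hx', hx⟩ := hx
          obtain ⟨y', hy', hy⟩ := hy
          refine ⟨x' + y', add_mem hx' hy', ?_⟩
          rw [ψ_add, ψ_add, smul_add, hx, hy] }
  let e : (Ring.jacobson Λ • (⊤ : Submodule Λ X) : Submodule Λ X) →ₗ[Λ]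
      (ModuleCat.restrictScalars φ.toRingHom).obj (.of Γ N) :=
    { toFun := fun x => (⟨ψ x, x, x.2, rfl⟩ : N)
      map_add' := fun x y => Subtype.ext (ψ_add x y)
      map_smul' := fun a x => Subtype.ext (ψ_smul a x) }
  refine ⟨.of Γ N, ⟨n, N.subtype, N.subtype_injective⟩,
    ⟨(ModuleCat.isFG Λ).isoMk (LinearEquiv.toModuleIso
      (LinearEquiv.ofBijective e ⟨fun x y h => ?_, ?_⟩))⟩⟩
  · exact Subtype.ext (ψ_inj (congrArg Subtype.val h))
  · rintro ⟨_, x, hx, rfl⟩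
    exact ⟨⟨x, hx⟩, rfl⟩

/-- Passing down a left idealized extension costs one layer: a torsionless `Λ`-module `X` is an
extension of the semisimple module `X / rad Λ • X` by `rad Λ • X`, which comes from a torsionless
`Γ`-module. -/
lemma exists_isTorsionless_le_extLayer_succ [IsArtinianRing Λ] [IsNoetherianRing Λ]
    [IsNoetherianRing Γ] {φ : Λ →ₐ[R] Γ} (hφ : IsLeftIdealizedExtension φ) {k : ℕ}
    {T : FGModuleCat.{u} Γ} (hT : IsTorsionless Γ ≤ extLayer (.singleton T) (k + 1)) :
    ∃ T' : FGModuleCat.{u} Λ, IsTorsionless Λ ≤ extLayer (.singleton T') (k + 2) := by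
  let S : FGModuleCat.{u} Λ := .of Λ (Λ ⧸ Ring.jacobson Λ)
  let T₀ := (restrictScalarsFG φ).obj T
  have hle : ∀ Y : FGModuleCat.{u} Λ, addClosure (.singleton (T₀ ⊞ S)) Y →
      ObjectProperty.singleton Y ≤ addClosure (.singleton (T₀ ⊞ S)) := by
    rintro Y hY _ ⟨⟩
    exact hY
  have h₁ := hle T₀ ((addClosure_singleton_self _).of_retract ⟨biprod.inl, biprod.fst, by simp⟩)
  have h₂ := hle S ((addClosure_singleton_self _).of_retract ⟨biprod.inr, biprod.snd, by simp⟩)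
  refine ⟨T₀ ⊞ S, fun X hX => ?_⟩
  obtain ⟨Y, hY, ⟨e⟩⟩ := exists_iso_restrictScalarsFG hφ hX
  refine extLayer_add_of_shortExact k 0
    (FGModuleCat.shortExact_quotient X (Ring.jacobson Λ • (⊤ : Submodule Λ X))) ?_ ?_
  · refine extLayer.of_iso (extLayer_mono h₁ k _ ?_) e
    exact extLayer.map _ (restrictScalarsFG_shortExact φ) (by rintro _ ⟨⟩; simp [T₀]) (hT Y hY)
  · obtain ⟨n, i, p, hpi⟩ := exists_retract_of_radicalTorsion (Λ := Λ)
      (M := X ⧸ (Ring.jacobson Λ • (⊤ : Submodule Λ X) : Submodule Λ X)) (by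
        rw [eq_top_iff]
        rintro x - j hj
        obtain ⟨x, rfl⟩ := Submodule.Quotient.mk_surjective _ x
        exact (Submodule.Quotient.mk_eq_zero _).2 (Submodule.smul_mem_smul hj trivial))
    obtain ⟨ρ⟩ := retract_of_comp_eq_id (M := .of Λ _) (N := .of Λ _) i p hpi
    exact addClosure_le_of_le h₂ _ ((addClosure_of_pi _ n).of_retract ρ)

end

/-- The key consequence of a chain of length `s`: all torsionless modules lie in one `[T]ₛ₊₁`.
At the end of the chain all modules lie in `add T`; then descend one extension at a time. -/
lemma exists_isTorsionless_le_extLayer {R : Type u} [CommRing R] [IsArtinianRing R] (s : ℕ) :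
    ∀ (Λ : Type u) [Ring Λ] [Algebra R Λ] [Module.Finite R Λ] [IsNoetherianRing Λ],
      HasLeftIdealizedChain R s Λ →
        ∃ T : FGModuleCat.{u} Λ, IsTorsionless Λ ≤ extLayer (.singleton T) (s + 1) := by
  induction s with
  | zero =>
    intro Λ _ _ _ _ h
    have : IsArtinianRing Λ := IsArtinianRing.of_finite R Λ
    obtain ⟨T, hT⟩ := exists_addClosure_eq_top h
    exact ⟨T, fun X _ => hT X⟩
  | succ s ih =>
    rintro Λ _ _ _ _ ⟨Γ, _, _, _, φ, hφ, -, h⟩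
    have : IsArtinianRing Λ := IsArtinianRing.of_finite R Λ
    have : IsNoetherianRing Γ := IsNoetherianRing.of_finite R Γ
    obtain ⟨T, hT⟩ := ih Γ h
    exact exists_isTorsionless_le_extLayer_succ hφ hT

section TorsionlessClosure

variable {Λ : Type u} [Ring Λ] [IsNoetherianRing Λ]

lemma IsTorsionless.of_mono {X Y : FGModuleCat.{u} Λ} (f : X ⟶ Y) [Mono f]
    (hY : IsTorsionless Λ Y) : IsTorsionless Λ X := by
  obtain ⟨n, g, hg⟩ := hY
  exact ⟨n, g ∘ₗ f.hom.hom, hg.comp ((FGModuleCat.mono_iff_injective f).1 inferInstance)⟩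

lemma IsTorsionless.biprod {X Y : FGModuleCat.{u} Λ} (hX : IsTorsionless Λ X)
    (hY : IsTorsionless Λ Y) : IsTorsionless Λ (X ⊞ Y) := by
  obtain ⟨m, f, hf⟩ := hX
  obtain ⟨n, g, hg⟩ := hY
  -- `X ⊞ Y` is an abstract biproduct: embed it in `X × Y` by its two projections.
  let p : (X ⊞ Y : FGModuleCat.{u} Λ) →ₗ[Λ] X × Y :=
    (biprod.fst : X ⊞ Y ⟶ X).hom.hom.prod (biprod.snd : X ⊞ Y ⟶ Y).hom.hom
  have hp : Function.Injective p := by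
    rw [← LinearMap.ker_eq_bot, LinearMap.ker_eq_bot']
    intro z hz
    have h : (biprod.fst ≫ biprod.inl + biprod.snd ≫ biprod.inr : X ⊞ Y ⟶ X ⊞ Y).hom.hom z =
        0 := by
      change (biprod.inl : X ⟶ X ⊞ Y).hom.hom (p z).1 +
        (biprod.inr : Y ⟶ X ⊞ Y).hom.hom (p z).2 = 0
      rw [hz]
      exact (congrArg₂ (· + ·) (map_zero _) (map_zero _)).trans (add_zero _)
    rwa [biprod.total] at h
  let e := (LinearEquiv.sumArrowLequivProdArrow (Fin m) (Fin n) Λ Λ).symm ≪≫ₗ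
    LinearEquiv.funCongrLeft Λ Λ finSumFinEquiv.symm
  exact ⟨m + n, e.toLinearMap ∘ₗ f.prodMap g ∘ₗ p,
    e.injective.comp ((hf.prodMap hg).comp hp)⟩

/-- Every finitely generated module is a quotient of a finitely generated free module, with a
torsionless kernel. -/
lemma exists_shortExact_free (X : FGModuleCat.{u} Λ) :
    ∃ (n : ℕ) (L : FGModuleCat.{u} Λ) (f : L ⟶ .of Λ (Fin n → Λ)) (g : .of Λ (Fin n → Λ) ⟶ X)
      (w : f ≫ g = 0), (ShortComplex.mk f g w).ShortExact ∧ IsTorsionless Λ L := by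
  obtain ⟨n, p, hp⟩ := Module.Finite.exists_fin' Λ X
  exact ⟨n, .of Λ (LinearMap.ker p), FGModuleCat.ofHom (LinearMap.ker p).subtype,
    FGModuleCat.ofHom p, FGModuleCat.hom_ext (LinearMap.ext fun x => x.2),
    (FGModuleCat.shortExact_iff _).2 ⟨Submodule.subtype_injective _,
      LinearMap.exact_subtype_ker_map p, hp⟩,
    n, (LinearMap.ker p).subtype, Submodule.subtype_injective _⟩

end TorsionlessClosure

end Torsionless

/-! ### Bounds from a chain of left idealized extensions -/

lemma exists_extLayer_eq_top_of_chain (R Λ : Type u) [CommRing R] [IsArtinianRing R] [Ring Λ]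
    [Algebra R Λ] [Module.Finite R Λ] [IsNoetherianRing Λ] {s : ℕ}
    (h : HasLeftIdealizedChain R s Λ) :
    ∃ T : FGModuleCat.{u} Λ, extLayer (.singleton T) (s + 2) = ⊤ := by
  obtain ⟨T, hT⟩ := exists_isTorsionless_le_extLayer s Λ h
  obtain ⟨E, _, _, hE, _, hcog⟩ := exists_finite_injective_cogenerator R Λ
  have : Injective (FGModuleCat.of Λ E) := ⟨fun g f hf => by
    have := (FGModuleCat.mono_iff_injective f).1 hf
    obtain ⟨k, hk⟩ := hE.out f.hom.hom this g.hom.hom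
    exact ⟨FGModuleCat.ofHom k, FGModuleCat.hom_ext (LinearMap.ext hk)⟩⟩
  refine exists_extLayer_eq_top (E := .of Λ E) (P := .of Λ Λ) (T := T) (fun X => ?_) s fun X => ?_
  · obtain ⟨n, f, hf⟩ := hcog X
    exact ⟨.of Λ (Fin n → E), FGModuleCat.ofHom f, addClosure_of_pi E n,
      (FGModuleCat.mono_iff_injective _).2 hf⟩
  · obtain ⟨n, L, f, g, w, hS, hL⟩ := exists_shortExact_free X
    exact ⟨L, _, f, g, w, hS, addClosure_of_pi Λ n, hT L hL⟩

lemma extDim_le_of_chain (R Λ : Type u) [CommRing R] [IsArtinianRing R] [Ring Λ]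
    [Algebra R Λ] [Module.Finite R Λ] [IsNoetherianRing Λ] {s : ℕ}
    (h : HasLeftIdealizedChain R s Λ) : extDim Λ ≤ s + 1 :=
  iInf₂_le (s + 1) (exists_extLayer_eq_top_of_chain R Λ h)

lemma derivedDim_le_of_chain (R Λ : Type u) [CommRing R] [IsArtinianRing R] [Ring Λ]
    [Algebra R Λ] [Module.Finite R Λ] [IsNoetherianRing Λ] {s : ℕ}
    (h : HasLeftIdealizedChain R s Λ) : derivedDim Λ ≤ 2 * s + 1 := by
  obtain ⟨T, hT⟩ := exists_isTorsionless_le_extLayer s Λ h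
  let _ : HasDerivedCategory (FGModuleCat.{u} Λ) := HasDerivedCategory.standard _
  refine iInf₂_le (2 * s + 1) ⟨boundedSingle T, triangEnvelopeIter_boundedSingle_eq_top
    (fun _ _ f _ => IsTorsionless.of_mono f) (fun _ _ => IsTorsionless.biprod) (fun X => ?_) hT⟩
  obtain ⟨n, L, f, g, w, hS, -⟩ := exists_shortExact_free X
  exact ⟨_, g, ⟨n, LinearMap.id, Function.injective_id⟩, hS.epi_g⟩

/-- For an artin algebra `Λ` over a commutative artinian ring `R`,
`tri.dim D^b(Λ-mod) ≤ 2 lrep.dis Λ + 1` and `ext.dim Λ ≤ lrep.dis Λ + 1`. -/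
theorem corollary4p6 (R Λ : Type u) [CommRing R] [IsArtinianRing R] [Ring Λ] [Algebra R Λ]
    [Module.Finite R Λ] :
    haveI : IsNoetherianRing Λ := IsNoetherianRing.of_finite R Λ
    derivedDim Λ ≤ 2 * lrepDis R Λ + 1 ∧ extDim Λ ≤ lrepDis R Λ + 1 := by
  have : IsNoetherianRing Λ := IsNoetherianRing.of_finite R Λ
  -- Without a chain both right-hand sides are `⊤`; otherwise the infimum is attained.
  by_cases h : ∃ s, HasLeftIdealizedChain R s Λ
  · obtain ⟨s, hs, heq⟩ : ∃ s : ℕ, HasLeftIdealizedChain R s Λ ∧ lrepDis R Λ = s := by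
      classical
      refine ⟨Nat.find h, Nat.find_spec h, le_antisymm ?_ ?_⟩
      · exact iInf₂_le (f := fun (s : ℕ) (_ : HasLeftIdealizedChain R s Λ) => (s : ℕ∞)) _
          (Nat.find_spec h)
      · exact le_iInf₂ fun t ht => Nat.cast_le.2 (Nat.find_min' h ht)
    rw [heq]
    exact ⟨derivedDim_le_of_chain R Λ hs, extDim_le_of_chain R Λ hs⟩
  · have htop : lrepDis R Λ = ⊤ := by
      simp only [lrepDis, iInf_eq_top]
      exact fun s hs => (h ⟨s, hs⟩).elim
    simp [htop]
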